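/- **Theorem 1.4 ($L^\infty$ regularity).** Let $\Omega=[0,2\pi]\times[0,\pi]$, let $L=\partial_t^2-\partial_x^2$ under the conditions $w(t,0)=w(t,\pi)=0$ and $w(t+2\pi,x)=w(t,x)$, and let $\sigma(L)=\{j^2-k^2: j\in\mathbb Z,\ j\ge 1,\ k\in\mathbb Z\}$ be its set of eigenvalues. Let $b>0$ with $-b\notin\sigma(L)$, and let $f(t,x,\xi)$, $g(t,x,\xi)$ be continuous real functions of $t\in\mathbb R$, $x\in[0,\pi]$, $\xi\in\mathbb R$, $2\pi$-periodic in $t$, such that, with $F(t,x,\xi)=\int_0^\xi f(t,x,s)\,ds$ and $G(t,x,\xi)=\int_0^\xi g(t,x,s)\,ds$: (h1) there are $p>1$, $q>1$, $c_0>0$ with $|f(t,x,\xi)|\le c_0(1+|\xi|^p)$ and $|g(t,x,\xi)|\le c_0(1+|\xi|^q)$ for all $t,x,\xi$; (h2) $f(t,x,\xi)=o(|\xi|)$ and $g(t,x,\xi)=o(|\xi|)$ as $\xi\to0$, uniformly in $(t,x)$; (h3) $(p+1)F(t,x,\xi)\le f(t,x,\xi)\,\xi$ and $(q+1)G(t,x,\xi)\le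 g(t,x,\xi)\,\xi$ for all $t,x,\xi$; (h4) $f(t,x,\xi)$ and $g(t,x,\xi)$ are nondecreasing in $\xi$. For $\varepsilon\in\mathbb R$, a weak solution of the system $$u_{tt}-u_{xx}+bu+\varepsilon v+f(t,x,u)=0,\qquad v_{tt}-v_{xx}+bv+\varepsilon u+g(t,x,v)=0,\tag{1.1}$$ $2\pi$-periodic in $t$ and with $u=v=0$ at $x=0$ and $x=\pi$, is a pair $(u,v)\in L^2(\Omega)\times L^2(\Omega)$ with $f(t,x,u),\,g(t,x,v)\in L^1(\Omega)$ such that $$\iint_\Omega\big[u(\varphi_{tt}-\varphi_{xx})+bu\varphi+\varepsilon v\varphi+f(t,x,u)\varphi\big]\,dt\,dx=0,\qquad \iint_\Omega\big[v(\psi_{tt}-\psi_{xx})+bv\psi+\varepsilon u\psi+g(t,x,v)\psi\big]\,dt\,dx=0$$ for all smooth functions $\varphi,\psi$ that are $2\pi$-periodic in $t$ and vanish at $x=0$ and $x=\pi$. Then there is $\varepsilon_0>0$ such that, whenever $|\varepsilon|<\varepsilon_0$, every weak solution $(u,v)$ of (1.1) lies in $L^\infty(\Omega)\times L^\infty(\Omega)$.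 Moreover both parts of each component are bounded: almost everywhere on $\Omega$ one has $u=u_1+P(t+x)-P(t-x)$ and $v=v_1+Q(t+x)-Q(t-x)$, where $u_1,v_1\in L^\infty(\Omega)$ are $L^2(\Omega)$-orthogonal to $\ker L$, the closed span of $\sin(jx)\cos(jt)$, $\sin(jx)\sin(jt)$, $j\ge1$, and $P,Q\in L^\infty(\mathbb R)$ are $2\pi$-periodic with mean zero. -/

import Mathlib

noncomputable section

namespace KleinGordon

open MeasureTheory Real
open scoped ContDiff

/-- The set `Ω = [0, 2π] × [0, π]`; its points are written `(t, x)`. -/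
def Omega : Set (ℝ × ℝ) := Set.Icc 0 (2 * π) ×ˢ Set.Icc 0 π

/-- Lebesgue measure `dt dx` on `Ω`. -/
def areaOmega : Measure (ℝ × ℝ) := volume.restrict Omega

/-- The eigenvalues `j² - k²` (`j = 1, 2, …`, `k ∈ ℤ`, eigenfunctions `sin (j x) e^{i k t}`) of
`∂ₜ² - ∂ₓ²` under the Dirichlet condition on `[0, π]` and `2π`-periodicity in time. -/
def waveSpectrum : Set ℝ := {l | ∃ (j : ℕ) (k : ℤ), 1 ≤ j ∧ l = (j : ℝ) ^ 2 - (k : ℝ) ^ 2}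

/-- The conditions on a nonlinearity `f(t, x, ξ)`, `t ∈ ℝ`, `x ∈ [0, π]`, `ξ ∈ ℝ`, with growth
exponent `p` and growth constant `c₀`. -/
structure IsAdmissible (p c₀ : ℝ) (f : ℝ → ℝ → ℝ → ℝ) : Prop where
  /-- `f` is jointly continuous. -/
  continuousOn : ContinuousOn (fun z : ℝ × ℝ × ℝ => f z.1 z.2.1 z.2.2)
    (Set.univ ×ˢ (Set.Icc 0 π ×ˢ Set.univ))
  /-- `f` is `2π`-periodic in `t`. -/
  periodic : ∀ t, ∀ x ∈ Set.Icc 0 π, ∀ ξ, f (t + 2 * π) x ξ = f t x ξ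
  /-- Polynomial growth. -/
  growth : ∀ t, ∀ x ∈ Set.Icc 0 π, ∀ ξ, |f t x ξ| ≤ c₀ * (1 + |ξ| ^ p)
  /-- `f(t, x, ξ) = o(|ξ|)` as `ξ → 0`, uniformly in `(t, x)`. -/
  small_at_zero : ∀ δ > 0, ∃ r > 0, ∀ t, ∀ x ∈ Set.Icc 0 π, ∀ ξ, |ξ| < r → |f t x ξ| ≤ δ * |ξ|
  /-- The Ambrosetti–Rabinowitz condition `(p + 1) F(t, x, ξ) ≤ f(t, x, ξ) ξ`. -/
  ambrosetti_rabinowitz : ∀ t, ∀ x ∈ Set.Icc 0 π, ∀ ξ,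
    (p + 1) * (∫ s in (0 : ℝ)..ξ, f t x s) ≤ f t x ξ * ξ
  /-- `f` is nondecreasing in `ξ`. -/
  monotone : ∀ t, ∀ x ∈ Set.Icc 0 π, Monotone (f t x)

/-- Test functions: smooth, `2π`-periodic in time, vanishing at `x = 0` and `x = π`.
(On `Ω` each of them has square-summable coefficients `(1 + |j² - k²|)^{1/2} φ_{jk}` in the
system `sin (j x) e^{i k t}`.) -/
structure IsTestFunction (φ : ℝ × ℝ → ℝ) : Prop where
  smooth : ContDiff ℝ ∞ φ
  periodic : ∀ t x, φ (t + 2 * π, x) = φ (t, x)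
  left : ∀ t, φ (t, 0) = 0
  right : ∀ t, φ (t, π) = 0

/-- The d'Alembert operator `φ_tt - φ_xx`. -/
def dAlembert (φ : ℝ × ℝ → ℝ) (z : ℝ × ℝ) : ℝ :=
  iteratedDeriv 2 (fun t => φ (t, z.2)) z.1 - iteratedDeriv 2 (fun x => φ (z.1, x)) z.2

/-- Weak solutions `(u, v) ∈ L²(Ω) × L²(Ω)` of
`u_tt - u_xx + b u + ε v + f(t, x, u) = 0`, `v_tt - v_xx + b v + ε u + g(t, x, v) = 0`,
`2π`-periodic in time and with Dirichlet conditions at `x = 0, π`. Only the values on the period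
cell `Ω` matter; both boundary conditions are carried by the test functions. The nonlinear terms
are required to be integrable, so that all the integrals converge. -/
structure IsWeakSolution (b ε : ℝ) (f g : ℝ → ℝ → ℝ → ℝ) (u v : ℝ × ℝ → ℝ) : Prop where
  memLp_u : MemLp u 2 areaOmega
  memLp_v : MemLp v 2 areaOmega
  integrable_f : Integrable (fun z => f z.1 z.2 (u z)) areaOmega
  integrable_g : Integrable (fun z => g z.1 z.2 (v z)) areaOmega
  eq_u : ∀ φ, IsTestFunction φ →
    ∫ z, (u z * dAlembert φ z + b * u z * φ z + ε * v z * φ z + f z.1 z.2 (u z) * φ z)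
      ∂areaOmega = 0
  eq_v : ∀ ψ, IsTestFunction ψ →
    ∫ z, (v z * dAlembert ψ z + b * v z * ψ z + ε * u z * ψ z + g z.1 z.2 (v z) * ψ z)
      ∂areaOmega = 0

/-- `w` is orthogonal in `L²(Ω)` to the kernel of the d'Alembert operator, which is the closed span
of the functions `sin (j x) cos (j t)` and `sin (j x) sin (j t)`, `j = 1, 2, …`. -/
def OrthogonalToKernel (w : ℝ × ℝ → ℝ) : Prop :=
  ∀ j : ℕ, 1 ≤ j →
    ∫ z, w z * (sin (j * z.2) * cos (j * z.1)) ∂areaOmega = 0 ∧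
    ∫ z, w z * (sin (j * z.2) * sin (j * z.1)) ∂areaOmega = 0

/-- `w = w₁ + P(t + x) - P(t - x)` almost everywhere on `Ω`, where `w₁` is essentially bounded and
orthogonal to the kernel of the d'Alembert operator, and `P` is an essentially bounded
`2π`-periodic function with mean zero. -/
def HasBoundedParts (w : ℝ × ℝ → ℝ) : Prop :=
  ∃ (w₁ : ℝ × ℝ → ℝ) (P : ℝ → ℝ),
    MemLp w₁ ⊤ areaOmega ∧ OrthogonalToKernel w₁ ∧
    Function.Periodic P (2 * π) ∧ MemLp P ⊤ volume ∧ (∫ s in (0 : ℝ)..(2 * π), P s) = 0 ∧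
    ∀ᵐ z ∂areaOmega, w z = w₁ z + (P (z.1 + z.2) - P (z.1 - z.2))

end KleinGordon

end

noncomputable section

namespace KleinGordon

open MeasureTheory Real
open scoped ContDiff

/-! Extend `u` oddly in `x` to a function `U` on the torus, and do the same with `h = b u + ε v +
f(t, x, u)`, giving `H`. Testing with trigonometric functions turns the first equation into `(j² -
k²) Û + Ĥ = 0`, where `H` is only known to be in `L¹`.

The wave operator has a bounded parametrix. A product of sawtooth functions has coefficients `8π² /
(j² - k²)` at the modes `j ≠ 0`, `k ≠ ±j`, and convolution with a bounded kernel maps `L¹` to `L^∞`.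
Hence `U` minus its projection on the kernel is bounded (`exists_bound_sub_kernelPart`). That
projection is `P(t + x) - P(t - x)`, where `P` is the average of `U` along characteristics
(`profile`), so only `P` and its counterpart `Q` for `v` remain to be bounded.

On the modes `k = ±j` the equation says that `h` is orthogonal to the kernel (`exists_profile`).
Test this with `T(P(t + x)) - T(P(t - x))`, where `T` is the sign function cut off to zero on `[-M,
M]`. Since `f` and `T` are both nondecreasing in their argument, replacing `u` by its bounded part
only lowers the nonlinear integrand (`mul_sub_ge_of_monotone`), which is therefore controlled by `K
∫ |T(P)|` with `K` independent of `M`. The linear terms of the two equations together dominate `(b -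
|ε|) M ∫ (|T(P)| + |T(Q)|)` (`cutoffSign_coupled_le`). When `|ε| < b` and `M` is large, this forces
`T(P) = T(Q) = 0` almost everywhere, that is, `|P|, |Q| ≤ M`. -/

/-- A real integrable function on a compact metrizable space whose integral against every
continuous function vanishes is zero almost everywhere. -/
theorem ae_eq_zero_of_forall_integral_continuous_mul {X : Type*} [TopologicalSpace X]
    [MeasurableSpace X] [BorelSpace X] [HasOuterApproxClosed X] {μ : Measure X}
    {F : X → ℝ} (hF : Integrable F μ)
    (h : ∀ g : BoundedContinuousFunction X ℝ, ∫ x, g x * F x ∂μ = 0) : F =ᵐ[μ] 0 := by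
  have hfin : ∀ G : X → ℝ, Integrable G μ → ∫⁻ x, ENNReal.ofReal (G x) ∂μ ≠ ⊤ := fun G hG =>
    ((lintegral_mono fun x => by
      rw [← ofReal_norm]
      exact ENNReal.ofReal_le_ofReal (le_abs_self _)).trans_lt hG.2).ne
  have hae : ∀ G : X → ℝ, Integrable G μ → AEMeasurable (fun x => ENNReal.ofReal (G x)) μ :=
    fun G hG => hG.aemeasurable.ennreal_ofReal
  have hneg : Integrable (fun x => -F x) μ := hF.neg
  have := isFiniteMeasure_withDensity (hfin F hF)
  have := isFiniteMeasure_withDensity (hfin _ hneg)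
  -- The positive and negative parts of `F` are densities of two finite measures with the same
  -- integrals of bounded continuous functions; such measures coincide, hence so do the densities.
  have key : μ.withDensity (fun x => ENNReal.ofReal (F x)) =
      μ.withDensity (fun x => ENNReal.ofReal (-F x)) := by
    apply ext_of_forall_integral_eq_of_IsFiniteMeasure
    intro g
    rw [integral_withDensity_eq_integral_toReal_smul₀ (hae F hF) (by simp),
      integral_withDensity_eq_integral_toReal_smul₀ (hae _ hneg) (by simp)]
    have hint : ∀ G : X → ℝ, Integrable G μ →
        Integrable (fun x => (ENNReal.ofReal (G x)).toReal • g x) μ := by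
      intro G hG
      simp only [smul_eq_mul]
      refine Integrable.mul_bdd (c := ‖g‖) ?_ g.continuous.aestronglyMeasurable
        (Filter.Eventually.of_forall fun x => g.norm_coe_le_norm x)
      simpa [ENNReal.toReal_ofReal'] using hG.pos_part
    rw [← sub_eq_zero, ← integral_sub (hint F hF) (hint _ hneg), ← h g]
    congr 1 with x
    simp only [smul_eq_mul, ENNReal.toReal_ofReal']
    rcases le_total 0 (F x) with hx | hx
    · rw [max_eq_left hx, max_eq_right (by linarith)]; ring
    · rw [max_eq_right hx, max_eq_left (by linarith)]; ring
  rw [withDensity_eq_iff (hae F hF) (hae _ hneg) (hfin F hF)] at key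
  filter_upwards [key] with x hx
  have h2 := congrArg ENNReal.toReal hx
  simp only [ENNReal.toReal_ofReal'] at h2
  rcases le_total 0 (F x) with hx | hx
  · rw [max_eq_left hx, max_eq_right (by linarith)] at h2; exact h2
  · rw [max_eq_right hx, max_eq_left (by linarith)] at h2; simp; linarith

/-! ### Fourier coefficients on the circle and the two-torus, and uniqueness. -/

section Circle

variable {p : ℝ}

theorem integrable_fourier_mul {X : Type*} [MeasurableSpace X] {μ : Measure X} {F : X → ℂ}
    (hF : Integrable F μ) (n : ℤ) {a : X → AddCircle p} (ha : Measurable a) :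
    Integrable (fun x => fourier n (a x) * F x) μ := by
  refine Integrable.bdd_mul (c := 1) hF ?_ ?_
  · exact ((fourier n).continuous.measurable.comp ha).aestronglyMeasurable
  · exact Filter.Eventually.of_forall fun x => by
      simp only [fourier_apply, Circle.norm_coe, le_refl]

theorem fourier_apply_add (n : ℤ) (x y : AddCircle p) :
    fourier n (x + y) = fourier n x * fourier n y := by
  simp [fourier_apply, smul_add, AddCircle.toCircle_add]

theorem fourier_apply_neg (n : ℤ) (x : AddCircle p) : fourier n (-x) = fourier (-n) x := by
  simp [fourier_apply]

variable [hp : Fact (0 < p)]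

/-- The functional `g ↦ ∫ g F` is continuous for the sup norm, with bound `‖F‖₁`, so its kernel is
closed; it contains the trigonometric polynomials, which are dense. -/
theorem integral_continuousMap_mul_eq_zero {F : AddCircle p → ℂ} (hF : Integrable F)
    (h : ∀ n : ℤ, ∫ x, fourier n x * F x = 0) (g : C(AddCircle p, ℂ)) :
    ∫ x, g x * F x = 0 := by
  have hint : ∀ g : C(AddCircle p, ℂ), Integrable (fun x => g x * F x) := fun g =>
    Integrable.bdd_mul (c := ‖g‖) hF g.continuous.aestronglyMeasurable
      (Filter.Eventually.of_forall fun x => g.norm_coe_le_norm x)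
  let l : C(AddCircle p, ℂ) →ₗ[ℂ] ℂ :=
    { toFun := fun g => ∫ x, g x * F x
      map_add' := fun g₁ g₂ => by
        rw [← integral_add (hint g₁) (hint g₂)]; simp [add_mul]
      map_smul' := fun c g => by
        rw [RingHom.id_apply, smul_eq_mul, ← integral_const_mul]; simp [mul_assoc] }
  let L : C(AddCircle p, ℂ) →L[ℂ] ℂ := l.mkContinuous (∫ x, ‖F x‖) fun g => by
    refine (norm_integral_le_integral_norm _).trans ?_
    rw [← integral_mul_const]
    refine integral_mono (hint g).norm (hF.norm.mul_const _) fun x => ?_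
    simp only [norm_mul]
    rw [mul_comm]
    gcongr
    exact g.norm_coe_le_norm x
  have hL : Submodule.span ℂ (Set.range (@fourier p)) ≤ L.ker := by
    rw [Submodule.span_le]
    rintro _ ⟨n, rfl⟩
    exact h n
  have := Submodule.topologicalClosure_minimal _ hL L.isClosed_ker
  rw [span_fourier_closure_eq_top] at this
  exact this (Submodule.mem_top (x := g))

/-- An integrable function on the circle all of whose Fourier coefficients vanish is zero almost
everywhere. -/
theorem ae_eq_zero_of_integral_fourier_mul {F : AddCircle p → ℂ} (hF : Integrable F)
    (h : ∀ n : ℤ, ∫ x, fourier n x * F x = 0) : F =ᵐ[volume] 0 := by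
  have hc := integral_continuousMap_mul_eq_zero hF h
  have hint : ∀ g : BoundedContinuousFunction (AddCircle p) ℝ,
      Integrable (fun x => (g x : ℂ) * F x) := fun g =>
    Integrable.bdd_mul (c := ‖g‖) hF
      (Complex.continuous_ofReal.comp g.continuous).aestronglyMeasurable
      (Filter.Eventually.of_forall fun x => by
        simpa using g.norm_coe_le_norm x)
  have h0 : ∀ g : BoundedContinuousFunction (AddCircle p) ℝ, ∫ x, (g x : ℂ) * F x = 0 := fun g =>
    hc ⟨fun x => (g x : ℂ), Complex.continuous_ofReal.comp g.continuous⟩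
  have hre : (fun x => (F x).re) =ᵐ[volume] 0 := by
    refine ae_eq_zero_of_forall_integral_continuous_mul hF.re fun g => ?_
    have := integral_re (hint g)
    rw [h0 g] at this
    simpa using this
  have him : (fun x => (F x).im) =ᵐ[volume] 0 := by
    refine ae_eq_zero_of_forall_integral_continuous_mul hF.im fun g => ?_
    have := integral_im (hint g)
    rw [h0 g] at this
    simpa using this
  filter_upwards [hre, him] with x h1 h2
  exact Complex.ext h1 h2

/-- The integral of `U` against the character `(t, x) ↦ e^{-i (k t + j x)}` of the two-dimensional
torus. -/
def torusCoeff (U : AddCircle p × AddCircle p → ℂ) (k j : ℤ) : ℂ :=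
  ∫ z, fourier (-k) z.1 * (fourier (-j) z.2 * U z)

theorem integrable_torusCoeff {U : AddCircle p × AddCircle p → ℂ} (hU : Integrable U) (k j : ℤ) :
    Integrable (fun z : AddCircle p × AddCircle p =>
      fourier (-k) z.1 * (fourier (-j) z.2 * U z)) :=
  integrable_fourier_mul (integrable_fourier_mul hU _ measurable_snd) _ measurable_fst

theorem torusCoeff_sub {U V : AddCircle p × AddCircle p → ℂ} (hU : Integrable U)
    (hV : Integrable V) (k j : ℤ) :
    torusCoeff (fun z => U z - V z) k j = torusCoeff U k j - torusCoeff V k j := by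
  rw [torusCoeff, torusCoeff, torusCoeff,
    ← integral_sub (integrable_torusCoeff hU k j) (integrable_torusCoeff hV k j)]
  simp only [mul_sub]

theorem torusCoeff_add {U V : AddCircle p × AddCircle p → ℂ} (hU : Integrable U)
    (hV : Integrable V) (k j : ℤ) :
    torusCoeff (fun z => U z + V z) k j = torusCoeff U k j + torusCoeff V k j := by
  rw [torusCoeff, torusCoeff, torusCoeff,
    ← integral_add (integrable_torusCoeff hU k j) (integrable_torusCoeff hV k j)]
  simp only [mul_add]

theorem torusCoeff_const_mul (c : ℂ) (U : AddCircle p × AddCircle p → ℂ) (k j : ℤ) :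
    torusCoeff (fun z => c * U z) k j = c * torusCoeff U k j := by
  rw [torusCoeff, torusCoeff, ← integral_const_mul]
  congr 1 with z
  ring

/-- An integrable function on the two-dimensional torus all of whose Fourier coefficients vanish
is zero almost everywhere. -/
theorem ae_eq_zero_of_torusCoeff {U : AddCircle p × AddCircle p → ℂ} (hU : Integrable U)
    (h : ∀ k j : ℤ, torusCoeff U k j = 0) : U =ᵐ[volume] 0 := by
  have h1 : ∀ j : ℤ, (fun t => ∫ x, fourier (-j) x * U (t, x)) =ᵐ[volume] 0 := by
    intro j
    have hj : Integrable (fun z : AddCircle p × AddCircle p => fourier (-j) z.2 * U z) :=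
      integrable_fourier_mul hU _ measurable_snd
    refine ae_eq_zero_of_integral_fourier_mul hj.integral_prod_left fun n => ?_
    have := h (-n) j
    rw [torusCoeff, Measure.volume_eq_prod, integral_prod] at this
    · simpa [integral_const_mul] using this
    · exact integrable_torusCoeff hU (-n) j
  -- There are countably many frequencies `j`, so one null set of times serves for all of them.
  have h2 : ∀ᵐ t : AddCircle p, (fun x => U (t, x)) =ᵐ[volume] 0 := by
    rw [Measure.volume_eq_prod] at hU
    filter_upwards [ae_all_iff.2 h1, hU.prod_right_ae] with t ht hUt
    exact ae_eq_zero_of_integral_fourier_mul hUt fun n => by simpa using ht (-n)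
  have h3 : ∫ z, ‖U z‖ = 0 := by
    rw [Measure.volume_eq_prod, integral_prod _ hU.norm]
    refine integral_eq_zero_of_ae ?_
    filter_upwards [h2] with t ht
    refine integral_eq_zero_of_ae ?_
    filter_upwards [ht] with x hx
    simp [hx]
  rw [integral_eq_zero_iff_of_nonneg (fun z => norm_nonneg _) hU.norm] at h3
  filter_upwards [h3] with z hz
  simpa using hz

/-- Translation by half a wavelength, `p / (2n)`, preserves the integral and changes the sign of the
character. -/
theorem integral_fourier_of_ne_zero {n : ℤ} (hn : n ≠ 0) :
    ∫ x : AddCircle p, fourier n x = 0 := by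
  have h := integral_add_right_eq_self (μ := (volume : Measure (AddCircle p)))
    (fun x => fourier n x) ((p / 2 / n : ℝ) : AddCircle p)
  simp only [fourier_add_half_inv_index hn hp.out, integral_neg] at h
  linear_combination (-1 / 2 : ℂ) * h

theorem integral_fourier_zero : ∫ x : AddCircle p, fourier 0 x = p := by
  simp [Measure.real, hp.out.le]

theorem MeasurePreserving.integral_comp_of_aestronglyMeasurable {X Y E : Type*}
    [MeasurableSpace X] [MeasurableSpace Y] [NormedAddCommGroup E] [NormedSpace ℝ E]
    {μ : Measure X} {ν : Measure Y} {m : X → Y} (hm : MeasurePreserving m μ ν) {F : Y → E}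
    (hF : AEStronglyMeasurable F ν) : ∫ x, F (m x) ∂μ = ∫ y, F y ∂ν := by
  rw [← hm.map_eq, integral_map hm.aemeasurable (by rwa [hm.map_eq])]

theorem measurePreserving_neg_snd : MeasurePreserving
    (fun z : AddCircle p × AddCircle p => (z.1, -z.2)) :=
  (MeasurePreserving.id _).prod (Measure.measurePreserving_neg _)

theorem torusCoeff_neg_snd {U : AddCircle p × AddCircle p → ℂ} (hU : Integrable U) (k j : ℤ) :
    torusCoeff (fun z => U (z.1, -z.2)) k j = torusCoeff U k (-j) := by
  rw [torusCoeff, torusCoeff, ← MeasurePreserving.integral_comp_of_aestronglyMeasurable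
    measurePreserving_neg_snd (integrable_torusCoeff hU k (-j)).aestronglyMeasurable]
  simp only [fourier_apply_neg, neg_neg]

theorem torusCoeff_neg_of_odd {U : AddCircle p × AddCircle p → ℂ} (hU : Integrable U)
    (hodd : ∀ t x, U (t, -x) = -U (t, x)) (k j : ℤ) :
    torusCoeff U k (-j) = -torusCoeff U k j := by
  rw [← torusCoeff_neg_snd hU]
  simp only [hodd]
  simp [torusCoeff, integral_neg]

/-! ### Averages along characteristics, the kernel projection and convolution on the Fourier side.
-/

/-- The average of `U` along the characteristic `t + x = s`. -/
def profile (U : AddCircle p × AddCircle p → ℝ) (s : AddCircle p) : ℝ :=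
  p⁻¹ * ∫ x, U (s - x, x)

theorem measurePreserving_sub_fst : MeasurePreserving
    (fun z : AddCircle p × AddCircle p => (z.1 - z.2, z.2)) :=
  measurePreserving_sub_prod _ _

theorem measurePreserving_add_fst : MeasurePreserving
    (fun z : AddCircle p × AddCircle p => (z.1 + z.2, z.2)) :=
  measurePreserving_add_prod _ _

theorem integrable_profile {U : AddCircle p × AddCircle p → ℝ} (hU : Integrable U) :
    Integrable (profile U) := by
  have h := measurePreserving_sub_fst.integrable_comp_of_integrable hU
  exact h.integral_prod_left.const_mul _

theorem measurable_profile {U : AddCircle p × AddCircle p → ℝ} (hU : Measurable U) :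
    Measurable (profile U) := by
  have h : StronglyMeasurable (fun z : AddCircle p × AddCircle p => U (z.1 - z.2, z.2)) :=
    (hU.comp (by fun_prop)).stronglyMeasurable
  exact (h.integral_prod_right (ν := volume)).measurable.const_mul _

/-- The measure-preserving shear `(s, x) ↦ (s - x, x)` makes `t + x` a coordinate; Fubini then
integrates `U` along each characteristic. -/
theorem integral_smul_comp_add {E : Type*} [NormedAddCommGroup E] [NormedSpace ℝ E]
    [CompleteSpace E]
    {U : AddCircle p × AddCircle p → ℝ} (hU : Integrable U)
    {φ : AddCircle p → E} (hφ : StronglyMeasurable φ) {C : ℝ} (hC : ∀ s, ‖φ s‖ ≤ C) :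
    ∫ z, U z • φ (z.1 + z.2) = p • ∫ s, profile U s • φ s := by
  have hint : Integrable (fun z : AddCircle p × AddCircle p => U z • φ (z.1 + z.2)) :=
    hU.smul_bdd C (hφ.comp_measurable (by fun_prop)).aestronglyMeasurable
      (Filter.Eventually.of_forall fun z => hC _)
  rw [← MeasurePreserving.integral_comp_of_aestronglyMeasurable measurePreserving_sub_fst
    hint.aestronglyMeasurable, ← integral_smul, Measure.volume_eq_prod, integral_prod]
  · congr 1 with s
    simp only [sub_add_cancel, profile]
    rw [integral_smul_const, smul_smul, ← mul_assoc, mul_inv_cancel₀ hp.out.ne', one_mul]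
  · exact measurePreserving_sub_fst.integrable_comp_of_integrable hint

theorem integrable_comp_add {E : Type*} [NormedAddCommGroup E] {P : AddCircle p → E}
    (hP : Integrable P) :
    Integrable (fun z : AddCircle p × AddCircle p => P (z.1 + z.2)) :=
  measurePreserving_add_fst.integrable_comp_of_integrable (g := fun z => P z.1)
    (hP.comp_fst volume)

theorem integrable_comp_sub {E : Type*} [NormedAddCommGroup E] {P : AddCircle p → E}
    (hP : Integrable P) :
    Integrable (fun z : AddCircle p × AddCircle p => P (z.1 - z.2)) :=
  measurePreserving_sub_fst.integrable_comp_of_integrable (g := fun z => P z.1)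
    (hP.comp_fst volume)

/-- The same shear separates the variables. The second factor vanishes unless `k = j`, so functions
of `t + x` live on one diagonal of the light cone. -/
theorem torusCoeff_comp_add {P : AddCircle p → ℂ} (hP : Integrable P) (k j : ℤ) :
    torusCoeff (fun z => P (z.1 + z.2)) k j =
      (∫ s, fourier (-k) s * P s) * ∫ x : AddCircle p, fourier (k - j) x := by
  have h := (integrable_torusCoeff (integrable_comp_add hP) k j).aestronglyMeasurable
  rw [torusCoeff, ← MeasurePreserving.integral_comp_of_aestronglyMeasurable
    measurePreserving_sub_fst h, ← integral_prod_mul, Measure.volume_eq_prod]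
  congr 1 with z
  simp only [sub_add_cancel]
  rw [sub_eq_add_neg, fourier_apply_add, fourier_apply_neg, neg_neg, sub_eq_add_neg, fourier_add]
  ring

theorem torusCoeff_comp_sub {P : AddCircle p → ℂ} (hP : Integrable P) (k j : ℤ) :
    torusCoeff (fun z => P (z.1 - z.2)) k j =
      (∫ s, fourier (-k) s * P s) * ∫ x : AddCircle p, fourier (-k - j) x := by
  have h := (integrable_torusCoeff (integrable_comp_sub hP) k j).aestronglyMeasurable
  rw [torusCoeff, ← MeasurePreserving.integral_comp_of_aestronglyMeasurable
    measurePreserving_add_fst h, ← integral_prod_mul, Measure.volume_eq_prod]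
  congr 1 with z
  simp only [add_sub_cancel_right]
  rw [fourier_apply_add, sub_eq_add_neg, fourier_add]
  ring

theorem torusCoeff_eq_integral_profile {U : AddCircle p × AddCircle p → ℝ} (hU : Integrable U)
    (k : ℤ) : torusCoeff (fun z => (U z : ℂ)) k k =
      p * ∫ s, fourier (-k) s * (profile U s : ℂ) := by
  have h := integral_smul_comp_add hU (φ := fun s => (fourier (-k) s : ℂ))
    (fourier (-k)).continuous.stronglyMeasurable (C := 1)
    (fun s => by simp only [fourier_apply, Circle.norm_coe, le_refl])
  simp only [Complex.real_smul] at h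
  rw [torusCoeff]
  simp only [mul_comm (fourier (-k) _ : ℂ) (profile U _ : ℂ)]
  rw [← h]
  congr 1 with z
  rw [fourier_apply_add]
  ring

/-- The projection of an odd function on the kernel of the d'Alembert operator has the same
coefficients on the light cone `k = ± j`, and no others. -/
theorem torusCoeff_kernelPart {U : AddCircle p × AddCircle p → ℝ} (hU : Integrable U)
    (hodd : ∀ t x, U (t, -x) = -U (t, x)) (k j : ℤ) :
    torusCoeff (fun z => ((profile U (z.1 + z.2) - profile U (z.1 - z.2) : ℝ) : ℂ)) k j =
      if k = j ∨ k = -j then torusCoeff (fun z => (U z : ℂ)) k j else 0 := by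
  have hP : Integrable (fun s => (profile U s : ℂ)) := (integrable_profile hU).ofReal
  have hUc : Integrable (fun z => (U z : ℂ)) := hU.ofReal
  have hoddc : ∀ t x, (U (t, -x) : ℂ) = -(U (t, x) : ℂ) := fun t x => by simp [hodd]
  push_cast
  rw [torusCoeff_sub (integrable_comp_add hP) (integrable_comp_sub hP), torusCoeff_comp_add hP,
    torusCoeff_comp_sub hP]
  have hdiag := torusCoeff_eq_integral_profile hU k
  have hneg := torusCoeff_neg_of_odd hUc hoddc k k
  split_ifs with h
  -- At the origin the two diagonals meet and both profile terms contribute; they cancel, and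
  -- oddness makes the coefficient of `U` vanish there too.
  · by_cases hk : k = 0
    · subst hk
      have hj : j = 0 := by omega
      subst hj
      rw [neg_zero] at hneg
      have h0 : torusCoeff (fun z => (U z : ℂ)) 0 0 = 0 := by linear_combination hneg / 2
      rw [h0]
      simp
    · rcases h with rfl | h
      · rw [integral_fourier_of_ne_zero (n := -k - k) (by omega), sub_self, integral_fourier_zero,
          hdiag]
        ring
      · obtain rfl : j = -k := by omega
        rw [integral_fourier_of_ne_zero (n := k - -k) (by omega), sub_neg_eq_add, neg_add_cancel,
          integral_fourier_zero, hneg, hdiag]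
        ring
  · push Not at h
    rw [integral_fourier_of_ne_zero (n := k - j) (by omega),
      integral_fourier_of_ne_zero (n := -k - j) (by omega)]
    ring

/-- Multiplying both factors by the same character commutes with convolution, so this reduces to the
fact that the integral of a convolution is the product of the integrals. -/
theorem torusCoeff_convolution {H K : AddCircle p × AddCircle p → ℂ} (hH : Integrable H)
    (hK : Integrable K) (k j : ℤ) :
    torusCoeff (fun z => ∫ w, H w * K (z - w)) k j = torusCoeff H k j * torusCoeff K k j := by
  have : (volume : Measure (AddCircle p × AddCircle p)).IsAddRightInvariant :=
    inferInstanceAs (Measure.IsAddRightInvariant (Measure.prod volume volume))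
  have h := integral_convolution (ContinuousLinearMap.mul ℂ ℂ) (μ := volume) (ν := volume)
    (integrable_torusCoeff hH k j) (integrable_torusCoeff hK k j)
  rw [ContinuousLinearMap.mul_apply'] at h
  rw [torusCoeff, torusCoeff, torusCoeff, ← h]
  congr 1 with z
  rw [convolution_def, ← mul_assoc, ← integral_const_mul]
  congr 1 with w
  simp only [ContinuousLinearMap.mul_apply', Prod.fst_sub, Prod.snd_sub]
  have h1 : ∀ (n : ℤ) (x y : AddCircle p), (fourier n x : ℂ) = fourier n y * fourier n (x - y) :=
    fun n x y => by rw [← fourier_apply_add, add_sub_cancel]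
  rw [h1 (-k) z.1 w.1, h1 (-j) z.2 w.2]
  ring

end Circle

instance factTwoPiPos : Fact (0 < 2 * π) := ⟨two_pi_pos⟩

theorem integrable_complex_ofReal {X : Type*} [MeasurableSpace X] {μ : Measure X} {F : X → ℝ}
    (hF : Integrable F μ) : Integrable (fun x => (F x : ℂ)) μ := hF.ofReal

/-! ### A bounded parametrix for the wave operator, built from sawtooth functions. -/

/-- The `2π`-periodic sawtooth function, equal to `π - x` on `(0, 2π]`. -/
def sawtooth (x : AddCircle (2 * π)) : ℝ := π - AddCircle.equivIoc (2 * π) 0 x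

theorem measurable_sawtooth : Measurable sawtooth :=
  measurable_const.sub (measurable_subtype_coe.comp
    (AddCircle.measurableEquivIoc (2 * π) 0).measurable)

theorem abs_sawtooth_le (x : AddCircle (2 * π)) : |sawtooth x| ≤ π := by
  have h := (AddCircle.equivIoc (2 * π) 0 x).2
  rw [Set.mem_Ioc] at h
  rw [sawtooth, abs_le]
  constructor <;> linarith

theorem integrable_sawtooth : Integrable sawtooth :=
  Integrable.of_bound measurable_sawtooth.aestronglyMeasurable π
    (Filter.Eventually.of_forall abs_sawtooth_le)

theorem fourier_two_pi_coe (n : ℤ) (t : ℝ) :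
    fourier n (t : AddCircle (2 * π)) = Complex.exp (n * t * Complex.I) := by
  rw [fourier_coe_apply]
  congr 1
  push_cast
  field_simp [Complex.ofReal_ne_zero.2 pi_ne_zero]

theorem integral_fourier_mul_sawtooth (n : ℤ) :
    ∫ x, fourier n x * (sawtooth x : ℂ) = if n = 0 then 0 else 2 * π * Complex.I / n := by
  rw [← AddCircle.intervalIntegral_preimage (2 * π) 0, zero_add]
  have h1 : ∫ t in (0 : ℝ)..2 * π, fourier n (t : AddCircle (2 * π)) * (sawtooth t : ℂ) =
      ∫ t in (0 : ℝ)..2 * π, Complex.exp (n * t * Complex.I) * (π - t) := by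
    refine intervalIntegral.integral_congr_ae (Filter.Eventually.of_forall fun t ht => ?_)
    rw [Set.uIoc_of_le two_pi_pos.le] at ht
    rw [fourier_two_pi_coe, sawtooth, AddCircle.equivIoc_coe_eq (by simpa using ht)]
    push_cast
    rfl
  rw [h1]
  split_ifs with hn
  · subst hn
    have h2 : ∀ t ∈ Set.uIcc 0 (2 * π), HasDerivAt
        (fun t : ℝ => (π * t - t ^ 2 / 2 : ℂ)) (Complex.exp ((0 : ℤ) * t * Complex.I) * (π - t)) t := by
      intro t _
      have := (((hasDerivAt_id (t : ℂ)).const_mul (π : ℂ)).sub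
        (((hasDerivAt_id (t : ℂ)).pow 2).div_const 2)).comp_ofReal
      convert this using 1
      · ext y
        simp
      · simp
    rw [intervalIntegral.integral_eq_sub_of_hasDerivAt h2
      (Continuous.intervalIntegrable (by fun_prop) _ _)]
    push_cast
    ring
  · have hc : (n : ℂ) ≠ 0 := by exact_mod_cast hn
    have hnI : (n * Complex.I : ℂ) ≠ 0 := mul_ne_zero hc Complex.I_ne_zero
    have h2 : ∀ t ∈ Set.uIcc 0 (2 * π), HasDerivAt
        (fun t : ℝ => ((π - t) * Complex.exp (n * t * Complex.I) / (n * Complex.I) +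
          Complex.exp (n * t * Complex.I) / (n * Complex.I) ^ 2 : ℂ))
        (Complex.exp (n * t * Complex.I) * (π - t)) t := by
      intro t _
      have he : HasDerivAt (fun t : ℂ => Complex.exp (n * t * Complex.I))
          (Complex.exp (n * t * Complex.I) * (n * 1 * Complex.I)) (t : ℂ) :=
        (((hasDerivAt_id (t : ℂ)).const_mul (n : ℂ)).mul_const Complex.I).cexp
      have := (((((hasDerivAt_id (t : ℂ)).const_sub (π : ℂ)).mul he).div_const
        (n * Complex.I)).add (he.div_const ((n * Complex.I) ^ 2))).comp_ofReal
      convert this using 1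
      · ext y
        simp
      · simp only [id]
        field_simp
        ring
    rw [intervalIntegral.integral_eq_sub_of_hasDerivAt h2
      (Continuous.intervalIntegrable (by fun_prop) _ _)]
    have hper : Complex.exp (n * ((2 * π : ℝ) : ℂ) * Complex.I) = 1 := by
      rw [Complex.exp_eq_one_iff]
      exact ⟨n, by push_cast; ring⟩
    rw [hper]
    push_cast
    simp only [mul_zero, zero_mul, Complex.exp_zero]
    field_simp
    rw [pow_succ, Complex.I_sq]
    ring

/-- In the coordinates `t` and `y = t + x` the character becomes `e^{i (j - k) t} e^{-i j y}` and
the integrand is a product. -/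
theorem torusCoeff_sawtooth_mul (k j : ℤ) :
    torusCoeff (fun z : AddCircle (2 * π) × AddCircle (2 * π) =>
      ((sawtooth z.1 * sawtooth (z.1 + z.2) : ℝ) : ℂ)) k j =
      (∫ x, fourier (j - k) x * (sawtooth x : ℂ)) * ∫ x, fourier (-j) x * (sawtooth x : ℂ) := by
  have hint : Integrable (fun z : AddCircle (2 * π) × AddCircle (2 * π) =>
      ((sawtooth z.1 * sawtooth (z.1 + z.2) : ℝ) : ℂ)) := by
    refine Integrable.ofReal (Integrable.bdd_mul (c := π) (integrable_comp_add integrable_sawtooth)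
      (measurable_sawtooth.comp measurable_fst).aestronglyMeasurable
      (Filter.Eventually.of_forall fun z => abs_sawtooth_le _))
  have hmp : MeasurePreserving
      (fun z : AddCircle (2 * π) × AddCircle (2 * π) => (z.1, z.2 - z.1)) :=
    measurePreserving_prod_sub _ _
  rw [torusCoeff, ← MeasurePreserving.integral_comp_of_aestronglyMeasurable hmp
    (integrable_torusCoeff hint k j).aestronglyMeasurable, ← integral_prod_mul,
    Measure.volume_eq_prod]
  congr 1 with z
  simp only [add_sub_cancel]
  rw [sub_eq_add_neg z.2, fourier_apply_add, fourier_apply_neg, neg_neg, sub_eq_add_neg,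
    fourier_add]
  push_cast
  ring

/-- A bounded kernel which inverts the d'Alembert operator on odd functions, up to functions in
the kernel of that operator. -/
def waveKernel (z : AddCircle (2 * π) × AddCircle (2 * π)) : ℝ :=
  sawtooth z.1 * (sawtooth (z.1 + z.2) + sawtooth (z.1 - z.2))

theorem measurable_waveKernel : Measurable waveKernel :=
  (measurable_sawtooth.comp measurable_fst).mul
    ((measurable_sawtooth.comp (by fun_prop)).add (measurable_sawtooth.comp (by fun_prop)))

theorem abs_waveKernel_le (z : AddCircle (2 * π) × AddCircle (2 * π)) :
    |waveKernel z| ≤ π * (π + π) := by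
  rw [waveKernel, abs_mul]
  gcongr
  · exact abs_sawtooth_le _
  · exact (abs_add_le _ _).trans (add_le_add (abs_sawtooth_le _) (abs_sawtooth_le _))

/-- Evenness in `x` ensures that convolution with this kernel keeps odd functions odd. -/
theorem waveKernel_neg_snd (t x : AddCircle (2 * π)) :
    waveKernel (t, -x) = waveKernel (t, x) := by
  simp only [waveKernel, sub_neg_eq_add, ← sub_eq_add_neg]
  ring

theorem integrable_waveKernel : Integrable waveKernel :=
  Integrable.of_bound measurable_waveKernel.aestronglyMeasurable _
    (Filter.Eventually.of_forall abs_waveKernel_le)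

/-- Partial fractions: the two sawtooth products contribute `4π² / (j (j - k))` and `4π² / (j (j +
k))`. -/
theorem torusCoeff_waveKernel {k j : ℤ} (hj : j ≠ 0) (h1 : k ≠ j) (h2 : k ≠ -j) :
    torusCoeff (fun z => (waveKernel z : ℂ)) k j =
      8 * π ^ 2 / ((j : ℂ) ^ 2 - (k : ℂ) ^ 2) := by
  have hint : Integrable (fun z : AddCircle (2 * π) × AddCircle (2 * π) =>
      ((sawtooth z.1 * sawtooth (z.1 + z.2) : ℝ) : ℂ)) := by
    refine Integrable.ofReal (Integrable.bdd_mul (c := π) (integrable_comp_add integrable_sawtooth)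
      (measurable_sawtooth.comp measurable_fst).aestronglyMeasurable
      (Filter.Eventually.of_forall fun z => abs_sawtooth_le _))
  have hsplit := torusCoeff_add hint (measurePreserving_neg_snd.integrable_comp_of_integrable hint)
    k j
  have href := torusCoeff_neg_snd hint k j
  simp only [Function.comp_def, ← sub_eq_add_neg] at hsplit href
  rw [href, torusCoeff_sawtooth_mul, torusCoeff_sawtooth_mul] at hsplit
  simp only [waveKernel, mul_add, Complex.ofReal_add]
  rw [hsplit]
  simp only [integral_fourier_mul_sawtooth]
  rw [if_neg (by omega), if_neg (by omega), if_neg (by omega), if_neg (by omega)]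
  have hjc : (j : ℂ) ≠ 0 := by exact_mod_cast hj
  have h1c : (j : ℂ) - k ≠ 0 := sub_ne_zero.2 (by exact_mod_cast h1.symm)
  have h2c : (j : ℂ) + k ≠ 0 := by exact_mod_cast (by omega : j + k ≠ 0)
  have h3c : -(j : ℂ) - k ≠ 0 := by
    rw [← neg_add']; exact neg_ne_zero.2 h2c
  have h4c : (j : ℂ) ^ 2 - (k : ℂ) ^ 2 ≠ 0 := by
    rw [sq_sub_sq]; exact mul_ne_zero h2c h1c
  push_cast
  rw [div_mul_div_comm, div_mul_div_comm, div_add_div _ _ (by simp [*]) (by simp [*]),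
    div_eq_div_iff (by simp [*]) h4c]
  ring_nf
  simp only [Complex.I_sq]
  ring

theorem integrable_profile_comp_sub {U : AddCircle (2 * π) × AddCircle (2 * π) → ℝ}
    (hU : Integrable U) : Integrable (fun z : AddCircle (2 * π) × AddCircle (2 * π) =>
      profile U (z.1 + z.2) - profile U (z.1 - z.2)) :=
  (integrable_comp_add (integrable_profile hU)).sub (integrable_comp_sub (integrable_profile hU))

theorem abs_profile_le {V : AddCircle (2 * π) × AddCircle (2 * π) → ℝ} {M : ℝ}
    (hM : ∀ z, |V z| ≤ M) (s : AddCircle (2 * π)) : |profile V s| ≤ M := by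
  have h : ‖∫ x, V (s - x, x)‖ ≤ M * (2 * π) := by
    refine (norm_integral_le_of_norm_le_const (C := M)
      (Filter.Eventually.of_forall fun x => hM _)).trans_eq ?_
    simp [Measure.real, pi_pos.le]
  rw [profile, abs_mul, abs_of_pos (inv_pos.2 two_pi_pos), inv_mul_le_iff₀ two_pi_pos]
  exact h.trans_eq (mul_comm _ _)

/-! ### Boundedness of the component orthogonal to the kernel. -/

/-- If `U` and `H` are odd and integrable and `U_tt - U_xx + H = 0` in the sense of Fourier
coefficients, then the component of `U` orthogonal to the kernel is bounded. -/
theorem exists_bound_sub_kernelPart {U H : AddCircle (2 * π) × AddCircle (2 * π) → ℝ}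
    (hU : Integrable U) (hH : Integrable H)
    (hUodd : ∀ t x, U (t, -x) = -U (t, x)) (hHodd : ∀ t x, H (t, -x) = -H (t, x))
    (hUH : ∀ k j : ℤ, ((j : ℂ) ^ 2 - (k : ℂ) ^ 2) * torusCoeff (fun z => (U z : ℂ)) k j +
      torusCoeff (fun z => (H z : ℂ)) k j = 0) :
    ∃ C, ∀ᵐ z, |U z - (profile U (z.1 + z.2) - profile U (z.1 - z.2))| ≤ C := by
  have hinv : (volume : Measure (AddCircle (2 * π) × AddCircle (2 * π))).IsAddRightInvariant :=
    inferInstanceAs (Measure.IsAddRightInvariant (Measure.prod volume volume))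
  -- `V` is bounded by `‖H‖₁` times the sup of the kernel, and solves the equation off the light
  -- cone; its own kernel part is arbitrary and is subtracted below.
  set V : AddCircle (2 * π) × AddCircle (2 * π) → ℝ :=
    fun z => -(8 * π ^ 2)⁻¹ * ∫ w, H w * waveKernel (z - w) with hVdef
  have hV : Integrable V :=
    (hH.integrable_convolution (ContinuousLinearMap.mul ℝ ℝ) integrable_waveKernel).const_mul _
  have hVodd : ∀ t x, V (t, -x) = -V (t, x) := by
    intro t x
    have hmeas : AEStronglyMeasurable (fun w => H w * waveKernel ((t, -x) - w)) volume :=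
      hH.aestronglyMeasurable.mul
        (measurable_waveKernel.comp (measurable_const.sub measurable_id)).aestronglyMeasurable
    simp only [hVdef]
    rw [← MeasurePreserving.integral_comp_of_aestronglyMeasurable measurePreserving_neg_snd hmeas,
      ← mul_neg, ← integral_neg]
    congr 2 with w
    have h : ((t, -x) - (w.1, -w.2) : AddCircle (2 * π) × AddCircle (2 * π)) =
        (t - w.1, -(x - w.2)) := by
      rw [Prod.mk_sub_mk, neg_sub_neg, neg_sub]
    rw [hHodd, h, waveKernel_neg_snd, neg_mul]
    rfl
  have hVbdd : ∀ z, |V z| ≤ (8 * π ^ 2)⁻¹ * ((∫ w, |H w|) * (π * (π + π))) := by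
    intro z
    simp only [hVdef]
    rw [abs_mul, abs_neg, abs_of_pos (by positivity : 0 < (8 * π ^ 2)⁻¹)]
    gcongr
    rw [← integral_mul_const]
    rw [← Real.norm_eq_abs (∫ _, _)]
    refine norm_integral_le_of_norm_le (hH.abs.mul_const _) (Filter.Eventually.of_forall fun w => ?_)
    rw [norm_mul]
    exact mul_le_mul_of_nonneg_left (abs_waveKernel_le _) (abs_nonneg _)
  have hVcoeff : ∀ k j, torusCoeff (fun z => (V z : ℂ)) k j =
      -(8 * π ^ 2 : ℂ)⁻¹ * (torusCoeff (fun z => (H z : ℂ)) k j *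
        torusCoeff (fun z => (waveKernel z : ℂ)) k j) := by
    intro k j
    rw [← torusCoeff_convolution (integrable_complex_ofReal hH) (integrable_complex_ofReal integrable_waveKernel), ← torusCoeff_const_mul]
    congr 1 with z
    simp only [hVdef]
    push_cast
    rw [← integral_complex_ofReal]
    push_cast
    rfl
  have hcoeff : ∀ k j, k ≠ j → k ≠ -j → torusCoeff (fun z => (U z : ℂ)) k j =
      torusCoeff (fun z => (V z : ℂ)) k j := by
    intro k j h1 h2
    -- The formula for the kernel coefficients excludes `j = 0`, but odd functions have no such
    -- modes.
    by_cases hj : j = 0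
    · subst hj
      have hu := torusCoeff_neg_of_odd (integrable_complex_ofReal hU) (fun t x => by simp [hUodd]) k 0
      have hv := torusCoeff_neg_of_odd (integrable_complex_ofReal hV) (fun t x => by simp [hVodd]) k 0
      rw [neg_zero] at hu hv
      linear_combination hu / 2 - hv / 2
    · have h4c : (j : ℂ) ^ 2 - (k : ℂ) ^ 2 ≠ 0 := by
        rw [sq_sub_sq]
        exact mul_ne_zero (by exact_mod_cast (by omega : j + k ≠ 0))
          (sub_ne_zero.2 (by exact_mod_cast h1.symm))
      have hpi : (π : ℂ) ≠ 0 := Complex.ofReal_ne_zero.2 pi_ne_zero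
      rw [hVcoeff, torusCoeff_waveKernel hj h1 h2]
      have := hUH k j
      field_simp
      linear_combination this
  have hzero : (fun z => ((U z - (profile U (z.1 + z.2) - profile U (z.1 - z.2)) : ℝ) : ℂ) -
      ((V z - (profile V (z.1 + z.2) - profile V (z.1 - z.2)) : ℝ) : ℂ)) =ᵐ[volume] 0 := by
    have hUN := integrable_profile_comp_sub hU
    have hVN := integrable_profile_comp_sub hV
    have hUc : Integrable (fun z => ((U z - (profile U (z.1 + z.2) -
        profile U (z.1 - z.2)) : ℝ) : ℂ)) := integrable_complex_ofReal (hU.sub hUN)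
    have hVc : Integrable (fun z => ((V z - (profile V (z.1 + z.2) -
        profile V (z.1 - z.2)) : ℝ) : ℂ)) := integrable_complex_ofReal (hV.sub hVN)
    refine ae_eq_zero_of_torusCoeff (hUc.sub hVc) fun k j => ?_
    rw [torusCoeff_sub hUc hVc]
    simp only [Complex.ofReal_sub (U _), Complex.ofReal_sub (V _)]
    rw [torusCoeff_sub (integrable_complex_ofReal hU) (integrable_complex_ofReal hUN), torusCoeff_sub (integrable_complex_ofReal hV) (integrable_complex_ofReal hVN),
      torusCoeff_kernelPart hU hUodd, torusCoeff_kernelPart hV hVodd]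
    split_ifs with h
    · simp
    · push Not at h
      rw [hcoeff k j h.1 h.2]
      ring
  set M := (8 * π ^ 2)⁻¹ * ((∫ w, |H w|) * (π * (π + π)))
  -- One `M` for `V` itself and one for each of the two values of its profile.
  refine ⟨M + (M + M), ?_⟩
  filter_upwards [hzero] with z hz
  have h : U z - (profile U (z.1 + z.2) - profile U (z.1 - z.2)) =
      V z - (profile V (z.1 + z.2) - profile V (z.1 - z.2)) := by
    rw [Pi.zero_apply, sub_eq_zero] at hz
    exact_mod_cast hz
  rw [h]
  refine (abs_sub _ _).trans (add_le_add (hVbdd z) ((abs_sub _ _).trans ?_))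
  exact add_le_add (abs_profile_le hVbdd _) (abs_profile_le hVbdd _)

/-- The diagonal coefficients of `H` are, up to the factor `2π`, the Fourier coefficients of its
profile. -/
theorem profile_ae_eq_zero {H : AddCircle (2 * π) × AddCircle (2 * π) → ℝ} (hH : Integrable H)
    (h : ∀ k : ℤ, torusCoeff (fun z => (H z : ℂ)) k k = 0) : profile H =ᵐ[volume] 0 := by
  have h0 : (fun s => (profile H s : ℂ)) =ᵐ[volume] 0 := by
    refine ae_eq_zero_of_integral_fourier_mul (integrable_complex_ofReal (integrable_profile hH)) fun n => ?_
    have := h (-n)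
    rw [torusCoeff_eq_integral_profile hH, neg_neg] at this
    exact (mul_eq_zero.1 this).resolve_left (by simp [pi_ne_zero])
  filter_upwards [h0] with s hs
  exact Complex.ofReal_eq_zero.1 hs

theorem integral_profile_eq_zero {U : AddCircle (2 * π) × AddCircle (2 * π) → ℝ}
    (hU : Integrable U) (hodd : ∀ t x, U (t, -x) = -U (t, x)) : ∫ s, profile U s = 0 := by
  have h := torusCoeff_eq_integral_profile hU 0
  have h0 := torusCoeff_neg_of_odd (integrable_complex_ofReal hU) (fun t x => by simp [hodd]) 0 0
  rw [neg_zero] at h0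
  have h1 : torusCoeff (fun z => (U z : ℂ)) 0 0 = 0 := by linear_combination h0 / 2
  rw [h1, neg_zero] at h
  simp only [fourier_zero, one_mul] at h
  rw [integral_complex_ofReal] at h
  have := (mul_eq_zero.1 h.symm).resolve_left (by simp [pi_ne_zero])
  exact_mod_cast this

/-! ### Passage from `Ω` to the torus by odd reflection. -/

theorem volume_restrict_Icc_eq_restrict_Ioc (a b : ℝ) :
    volume.restrict (Set.Icc a b) = volume.restrict (Set.Ioc a b) :=
  Measure.restrict_congr_set Ioc_ae_eq_Icc.symm

theorem areaOmega_eq_prod : areaOmega =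
    (volume.restrict (Set.Icc 0 (2 * π))).prod (volume.restrict (Set.Icc 0 π)) := by
  rw [areaOmega, Omega, Measure.prod_restrict, Measure.volume_eq_prod]

instance isFiniteMeasure_areaOmega : IsFiniteMeasure areaOmega := by
  rw [areaOmega_eq_prod]
  infer_instance

/-- The covering map `ℝ² → 𝕋²`. -/
def torusMk (z : ℝ × ℝ) : AddCircle (2 * π) × AddCircle (2 * π) := (z.1, z.2)

/-- The covering map `ℝ² → 𝕋²` preceded by the reflection `x ↦ -x`. -/
def torusMkNeg (z : ℝ × ℝ) : AddCircle (2 * π) × AddCircle (2 * π) := (z.1, (-z.2 : ℝ))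

theorem measurable_torusMk : Measurable torusMk :=
  (AddCircle.measurable_mk'.comp measurable_fst).prodMk
    (AddCircle.measurable_mk'.comp measurable_snd)

theorem measurable_torusMkNeg : Measurable torusMkNeg :=
  (AddCircle.measurable_mk'.comp measurable_fst).prodMk
    (AddCircle.measurable_mk'.comp measurable_snd.neg)

/-- The interval `[0, π]` and its reflection tile one period `(-π, π]` up to a null set. -/
theorem map_coe_add_map_coe_neg :
    (volume.restrict (Set.Icc 0 π)).map ((↑) : ℝ → AddCircle (2 * π)) +
      (volume.restrict (Set.Icc 0 π)).map (fun x : ℝ => ((-x : ℝ) : AddCircle (2 * π))) =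
      volume := by
  have h := (AddCircle.measurePreserving_mk (2 * π) (-π)).map_eq
  have hneg : (volume.restrict (Set.Icc 0 π)).map (fun x : ℝ => -x) =
      volume.restrict (Set.Ioc (-π) 0) := by
    have h1 := ((Measure.measurePreserving_neg (volume : Measure ℝ)).restrict_preimage
      (measurableSet_Icc (a := -π) (b := 0))).map_eq
    rw [← volume_restrict_Icc_eq_restrict_Ioc]
    rw [show (Neg.neg ⁻¹' Set.Icc (-π) 0 : Set ℝ) = Set.Icc 0 π by simp] at h1
    exact h1
  rw [show (fun x : ℝ => ((-x : ℝ) : AddCircle (2 * π))) =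
      ((↑) : ℝ → AddCircle (2 * π)) ∘ (fun x => -x) from rfl,
    ← Measure.map_map AddCircle.measurable_mk' measurable_neg, hneg,
    ← Measure.map_add _ _ AddCircle.measurable_mk', volume_restrict_Icc_eq_restrict_Ioc, add_comm,
    ← Measure.restrict_union _ measurableSet_Ioc, Set.Ioc_union_Ioc_eq_Ioc (by linarith [pi_pos])
      pi_pos.le]
  · rw [← h]
    congr 3
    ring
  · exact Set.disjoint_left.2 fun x hx hx' => not_lt.2 hx.2 hx'.1

theorem map_torusMk_add_map_torusMkNeg :
    areaOmega.map torusMk + areaOmega.map torusMkNeg = volume := by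
  have h := (AddCircle.measurePreserving_mk (2 * π) 0).map_eq
  rw [zero_add, ← volume_restrict_Icc_eq_restrict_Ioc] at h
  have hm : Measurable (fun x : ℝ => ((-x : ℝ) : AddCircle (2 * π))) :=
    AddCircle.measurable_mk'.comp measurable_neg
  rw [Measure.volume_eq_prod]
  nth_rewrite 2 [← map_coe_add_map_coe_neg]
  rw [Measure.prod_add, ← h,
    Measure.map_prod_map _ _ AddCircle.measurable_mk' AddCircle.measurable_mk',
    Measure.map_prod_map _ _ AddCircle.measurable_mk' hm, areaOmega_eq_prod]
  rfl

theorem integral_torus_eq {E : Type*} [NormedAddCommGroup E] [NormedSpace ℝ E]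
    {F : AddCircle (2 * π) × AddCircle (2 * π) → E} (hF : Integrable F) :
    Integrable (fun z => F (torusMk z)) areaOmega ∧
    Integrable (fun z => F (torusMkNeg z)) areaOmega ∧
    ∫ z, F z = ∫ z, (F (torusMk z) + F (torusMkNeg z)) ∂areaOmega := by
  rw [← map_torusMk_add_map_torusMkNeg, integrable_add_measure] at hF
  have h1 := hF.1.comp_measurable measurable_torusMk
  have h2 := hF.2.comp_measurable measurable_torusMkNeg
  refine ⟨h1, h2, ?_⟩
  rw [← map_torusMk_add_map_torusMkNeg, integral_add_measure hF.1 hF.2,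
    integral_map measurable_torusMk.aemeasurable hF.1.1,
    integral_map measurable_torusMkNeg.aemeasurable hF.2.1]
  exact (integral_add h1 h2).symm

theorem ae_areaOmega_of_ae_torus {q : AddCircle (2 * π) × AddCircle (2 * π) → Prop}
    (h : ∀ᵐ w, q w) : ∀ᵐ z ∂areaOmega, q (torusMk z) := by
  rw [← map_torusMk_add_map_torusMkNeg, ae_add_measure_iff] at h
  exact ae_of_ae_map measurable_torusMk.aemeasurable h.1

theorem ae_mem_interior_Omega :
    ∀ᵐ z ∂areaOmega, z.1 ∈ Set.Ioc 0 (2 * π) ∧ z.2 ∈ Set.Ioo 0 π := by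
  have h : areaOmega = volume.restrict (Set.Ioc 0 (2 * π) ×ˢ Set.Ioo 0 π) := by
    rw [areaOmega_eq_prod, volume_restrict_Icc_eq_restrict_Ioc, Measure.restrict_congr_set (Ioo_ae_eq_Icc (a := 0) (b := π)).symm,
      Measure.prod_restrict, Measure.volume_eq_prod]
  rw [h]
  exact ae_restrict_mem (measurableSet_Ioc.prod measurableSet_Ioo)

/-- The odd extension of `u(t, ·)` from `(0, π)` to `(-π, π]`. -/
def oddExtension (u : ℝ × ℝ → ℝ) (t x : ℝ) : ℝ :=
  if x < 0 then -u (t, -x) else if 0 < x ∧ x < π then u (t, x) else 0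

/-- The extension of a function on `Ω` to the torus, odd in `x`. -/
def oddLift (u : ℝ × ℝ → ℝ) (z : AddCircle (2 * π) × AddCircle (2 * π)) : ℝ :=
  oddExtension u (AddCircle.equivIoc (2 * π) 0 z.1) (AddCircle.equivIoc (2 * π) (-π) z.2)

theorem measurable_oddLift {u : ℝ × ℝ → ℝ} (hu : Measurable u) : Measurable (oddLift u) := by
  have ht : Measurable (fun z : AddCircle (2 * π) × AddCircle (2 * π) =>
      (AddCircle.equivIoc (2 * π) 0 z.1 : ℝ)) :=
    (measurable_subtype_coe.comp (AddCircle.measurableEquivIoc (2 * π) 0).measurable).comp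
      measurable_fst
  have hx : Measurable (fun z : AddCircle (2 * π) × AddCircle (2 * π) =>
      (AddCircle.equivIoc (2 * π) (-π) z.2 : ℝ)) :=
    (measurable_subtype_coe.comp (AddCircle.measurableEquivIoc (2 * π) (-π)).measurable).comp
      measurable_snd
  refine Measurable.ite (measurableSet_lt hx measurable_const) (hu.comp (ht.prodMk hx.neg)).neg
    (Measurable.ite ((measurableSet_lt measurable_const hx).inter
      (measurableSet_lt hx measurable_const)) (hu.comp (ht.prodMk hx)) measurable_const)

theorem equivIoc_coe_eq_self {x : ℝ} (hx : x ∈ Set.Ioc (-π) π) :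
    (AddCircle.equivIoc (2 * π) (-π) (x : AddCircle (2 * π)) : ℝ) = x := by
  rw [AddCircle.equivIoc_coe_eq]
  rwa [show -π + 2 * π = π by ring]

/-- Oddness holds at every point, not just almost everywhere: `0` and `π` are their own negatives on
the circle, and `oddExtension` is zero at both. -/
theorem oddLift_odd (u : ℝ × ℝ → ℝ) (t x : AddCircle (2 * π)) :
    oddLift u (t, -x) = -oddLift u (t, x) := by
  obtain ⟨ξ, hξ, rfl⟩ : ∃ ξ : ℝ, ξ ∈ Set.Ioc (-π) π ∧ (ξ : AddCircle (2 * π)) = x := by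
    refine ⟨AddCircle.equivIoc (2 * π) (-π) x, ?_, ?_⟩
    · have := (AddCircle.equivIoc (2 * π) (-π) x).2
      exact ⟨this.1, this.2.trans_eq (by ring)⟩
    · exact AddCircle.coe_equivIoc (a := -π)
  rcases hξ.2.lt_or_eq with h | h
  · have h2 := equivIoc_coe_eq_self (x := -ξ) ⟨by linarith, by linarith [hξ.1]⟩
    rw [AddCircle.coe_neg] at h2
    simp only [oddLift, equivIoc_coe_eq_self hξ, h2, oddExtension]
    rcases lt_trichotomy ξ 0 with h0 | h0 | h0
    · rw [if_neg (by linarith), if_pos ⟨by linarith, by linarith [hξ.1]⟩, if_pos h0, neg_neg]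
    · simp [h0]
    · rw [if_pos (by linarith), neg_neg, if_neg (by linarith), if_pos ⟨h0, h⟩]
  · subst h
    have hpi : -((π : ℝ) : AddCircle (2 * π)) = ((π : ℝ) : AddCircle (2 * π)) := by
      rw [← AddCircle.coe_neg, ← AddCircle.coe_add_period]
      congr 1
      ring
    rw [hpi]
    simp [oddLift, oddExtension, equivIoc_coe_eq_self hξ, pi_pos.le.not_gt]

theorem oddLift_torusMk (u : ℝ × ℝ → ℝ) {z : ℝ × ℝ} (ht : z.1 ∈ Set.Ioc 0 (2 * π))
    (hx : z.2 ∈ Set.Ioo 0 π) : oddLift u (torusMk z) = u z := by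
  simp only [oddLift, torusMk]
  rw [equivIoc_coe_eq_self ⟨by linarith [hx.1, pi_pos], hx.2.le⟩,
    AddCircle.equivIoc_coe_eq (by simpa using ht), oddExtension, if_neg hx.1.le.not_gt, if_pos (Set.mem_Ioo.1 hx)]

theorem oddLift_torusMkNeg (u : ℝ × ℝ → ℝ) {z : ℝ × ℝ} (ht : z.1 ∈ Set.Ioc 0 (2 * π))
    (hx : z.2 ∈ Set.Ioo 0 π) : oddLift u (torusMkNeg z) = -u z := by
  rw [← oddLift_torusMk u ht hx, ← oddLift_odd]
  simp [torusMk, torusMkNeg]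

theorem integrable_oddLift {u : ℝ × ℝ → ℝ} (hm : Measurable u) (hu : Integrable u areaOmega) :
    Integrable (oddLift u) := by
  have hmeas := measurable_oddLift hm
  rw [← map_torusMk_add_map_torusMkNeg, integrable_add_measure,
    integrable_map_measure hmeas.aestronglyMeasurable measurable_torusMk.aemeasurable,
    integrable_map_measure hmeas.aestronglyMeasurable measurable_torusMkNeg.aemeasurable]
  refine ⟨hu.congr ?_, hu.neg.congr ?_⟩
  · filter_upwards [ae_mem_interior_Omega] with z hz
    exact (oddLift_torusMk u hz.1 hz.2).symm
  · filter_upwards [ae_mem_interior_Omega] with z hz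
    exact (oddLift_torusMkNeg u hz.1 hz.2).symm

theorem integral_oddLift_smul {E : Type*} [NormedAddCommGroup E] [NormedSpace ℝ E]
    {u : ℝ × ℝ → ℝ} (hm : Measurable u) (hu : Integrable u areaOmega)
    {Φ : AddCircle (2 * π) × AddCircle (2 * π) → E} (hΦ : StronglyMeasurable Φ) {C : ℝ}
    (hC : ∀ z, ‖Φ z‖ ≤ C) :
    ∫ z, oddLift u z • Φ z = ∫ z, u z • (Φ (torusMk z) - Φ (torusMkNeg z)) ∂areaOmega := by
  have hint : Integrable (fun z => oddLift u z • Φ z) :=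
    (integrable_oddLift hm hu).smul_bdd C hΦ.aestronglyMeasurable (Filter.Eventually.of_forall hC)
  rw [(integral_torus_eq hint).2.2]
  refine integral_congr_ae ?_
  filter_upwards [ae_mem_interior_Omega] with z hz
  rw [oddLift_torusMk u hz.1 hz.2, oddLift_torusMkNeg u hz.1 hz.2, smul_sub, neg_smul,
    sub_eq_add_neg]

/-- Pairing with an odd function keeps only the odd part `-i sin (j x)` of `e^{-i j x}`, and the two
halves of the torus contribute equally; hence the factor `-2i`. -/
theorem torusCoeff_oddLift {u : ℝ × ℝ → ℝ} (hm : Measurable u) (hu : Integrable u areaOmega)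
    (k j : ℤ) : torusCoeff (fun z => (oddLift u z : ℂ)) k j =
      -2 * Complex.I * ((∫ z, u z * (sin (j * z.2) * cos (k * z.1)) ∂areaOmega : ℝ) -
        Complex.I * (∫ z, u z * (sin (j * z.2) * sin (k * z.1)) ∂areaOmega : ℝ)) := by
  have h := integral_oddLift_smul hm hu
    (Φ := fun z => (fourier (-k) z.1 * fourier (-j) z.2 : ℂ)) (C := 1)
    (Continuous.stronglyMeasurable (by fun_prop)) (fun z => by
      simp only [norm_mul, fourier_apply, Circle.norm_coe, mul_one, le_refl])
  have hbdd : ∀ w : ℝ × ℝ → ℝ, Continuous w → (∀ z, |w z| ≤ 1) →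
      Integrable (fun z => u z * w z) areaOmega := fun w hw hb =>
    hu.mul_bdd (c := 1) hw.aestronglyMeasurable (Filter.Eventually.of_forall hb)
  have hsc : ∀ a b : ℝ, |a| ≤ 1 → |b| ≤ 1 → |a * b| ≤ 1 := fun a b ha hb => by
    rw [abs_mul]
    exact mul_le_one₀ ha (abs_nonneg _) hb
  have h1 := hbdd (fun z => sin (j * z.2) * cos (k * z.1)) (by fun_prop)
    fun z => hsc _ _ (abs_sin_le_one _) (abs_cos_le_one _)
  have h2 := hbdd (fun z => sin (j * z.2) * sin (k * z.1)) (by fun_prop)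
    fun z => hsc _ _ (abs_sin_le_one _) (abs_sin_le_one _)
  have hL : torusCoeff (fun z => (oddLift u z : ℂ)) k j =
      ∫ z, oddLift u z • (fourier (-k) z.1 * fourier (-j) z.2 : ℂ) := by
    rw [torusCoeff]
    congr 1 with z
    rw [Complex.real_smul]
    ring
  rw [hL, h, ← integral_complex_ofReal, ← integral_complex_ofReal, ← integral_const_mul,
    ← integral_sub (integrable_complex_ofReal h1) ((integrable_complex_ofReal h2).const_mul _),
    ← integral_const_mul]
  congr 1 with z
  simp only [torusMk, torusMkNeg, fourier_two_pi_coe, Complex.real_smul]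
  push_cast
  have e1 : Complex.exp (-k * z.1 * Complex.I) =
      Complex.cos (k * z.1) - Complex.sin (k * z.1) * Complex.I := by
    rw [Complex.exp_mul_I, neg_mul, Complex.cos_neg, Complex.sin_neg]
    ring
  have e2 : Complex.exp (-j * z.2 * Complex.I) =
      Complex.cos (j * z.2) - Complex.sin (j * z.2) * Complex.I := by
    rw [Complex.exp_mul_I, neg_mul, Complex.cos_neg, Complex.sin_neg]
    ring
  have e3 : Complex.exp (-j * -z.2 * Complex.I) =
      Complex.cos (j * z.2) + Complex.sin (j * z.2) * Complex.I := by
    rw [Complex.exp_mul_I, neg_mul_neg]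
  rw [e1, e2, e3]
  ring

/-! ### Trigonometric test functions and the splitting of weak solutions. -/

theorem isTestFunction_sin_mul (k j : ℤ) {w : ℝ → ℝ} (hw : ContDiff ℝ ∞ w)
    (hper : ∀ t, w (t + 2 * π * k) = w t) :
    IsTestFunction (fun z => sin (j * z.2) * w (k * z.1)) where
  smooth := by fun_prop
  periodic t x := by
    simp only
    rw [← hper (k * t)]
    ring_nf
  left t := by simp
  right t := by simp [sin_int_mul_pi]

theorem iteratedDeriv_two_comp_mul {w : ℝ → ℝ} (hw : ContDiff ℝ ∞ w)
    (hw2 : ∀ t, iteratedDeriv 2 w t = -w t) (a c t : ℝ) :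
    iteratedDeriv 2 (fun t => c * w (a * t)) t = -(a ^ 2) * (c * w (a * t)) := by
  rw [iteratedDeriv_const_mul_field, iteratedDeriv_comp_const_mul (hw.of_le (by norm_cast))]
  simp only [hw2]
  ring

theorem dAlembert_sin_mul (k j : ℤ) {w : ℝ → ℝ} (hw : ContDiff ℝ ∞ w)
    (hw2 : ∀ t, iteratedDeriv 2 w t = -w t) (z : ℝ × ℝ) :
    dAlembert (fun z => sin (j * z.2) * w (k * z.1)) z =
      ((j : ℝ) ^ 2 - (k : ℝ) ^ 2) * (sin (j * z.2) * w (k * z.1)) := by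
  have hs2 : ∀ t, iteratedDeriv 2 sin t = -sin t := fun t => by simp [iteratedDeriv_succ]
  simp only [dAlembert]
  rw [iteratedDeriv_two_comp_mul hw hw2]
  simp only [mul_comm (sin _) (w (k * z.1))]
  rw [iteratedDeriv_two_comp_mul contDiff_sin hs2]
  ring

theorem iteratedDeriv_two_sin (t : ℝ) : iteratedDeriv 2 sin t = -sin t := by
  simp [iteratedDeriv_succ]

theorem iteratedDeriv_two_cos (t : ℝ) : iteratedDeriv 2 cos t = -cos t := by
  simp [iteratedDeriv_succ]

theorem integral_torus_comp_add {ψ : AddCircle (2 * π) → ℝ} (hψ : Integrable ψ) :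
    ∫ z, (ψ (z.1 + z.2 : ℝ) + ψ (z.1 - z.2 : ℝ)) ∂areaOmega = 2 * π * ∫ s, ψ s := by
  have h := (integral_torus_eq (integrable_comp_add hψ)).2.2
  have h2 := MeasurePreserving.integral_comp_of_aestronglyMeasurable
    (measurePreserving_add_fst (p := 2 * π)) (F := fun z => ψ z.1)
    (hψ.comp_fst volume).aestronglyMeasurable
  have h3 : ∫ z : AddCircle (2 * π) × AddCircle (2 * π), ψ z.1 = 2 * π * ∫ s, ψ s := by
    rw [Measure.volume_eq_prod, integral_fun_fst]
    simp [Measure.real, pi_pos.le]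
  rw [← h3, ← h2, h]
  simp only [torusMk, torusMkNeg, ← AddCircle.coe_add, sub_eq_add_neg]

/-- The part of the kernel of the d'Alembert operator with profile `P` reproduces `P`. -/
theorem integral_kernelPart_mul {P φ : AddCircle (2 * π) → ℝ} (hP : Integrable P)
    (hP0 : ∫ s, P s = 0) (hφ : Measurable φ) {C : ℝ} (hC : ∀ s, |φ s| ≤ C) :
    ∫ z, (P (z.1 + z.2 : ℝ) - P (z.1 - z.2 : ℝ)) *
      (φ (z.1 + z.2 : ℝ) - φ (z.1 - z.2 : ℝ)) ∂areaOmega = 2 * π * ∫ s, P s * φ s := by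
  have hPφ : Integrable (fun s => P s * φ s) :=
    hP.mul_bdd (c := C) hφ.aestronglyMeasurable (Filter.Eventually.of_forall hC)
  have hcross : Integrable (fun z : AddCircle (2 * π) × AddCircle (2 * π) =>
      P (z.1 - z.2) * φ (z.1 + z.2)) :=
    (integrable_comp_sub hP).mul_bdd (c := C) (hφ.comp (by fun_prop)).aestronglyMeasurable
      (Filter.Eventually.of_forall fun z => hC _)
  -- After a shear the inner integral is that of `φ(t + 2x)` over `x`. Doubling preserves the
  -- measure of the circle, so it does not depend on `t`, and the mean zero of `P` finishes.
  have hcross0 : ∫ z : AddCircle (2 * π) × AddCircle (2 * π), P (z.1 - z.2) * φ (z.1 + z.2) = 0 := by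
    rw [← MeasurePreserving.integral_comp_of_aestronglyMeasurable
      (measurePreserving_add_fst (p := 2 * π)) hcross.aestronglyMeasurable,
      Measure.volume_eq_prod, integral_prod]
    · have hin : ∀ t : AddCircle (2 * π), ∫ x, P (t + x - x) * φ (t + x + x) = P t * ∫ s, φ s := by
        intro t
        simp only [add_sub_cancel_right]
        rw [integral_const_mul]
        congr 1
        have hmp : MeasurePreserving (fun x : AddCircle (2 * π) => (2 : ℤ) • x) :=
          Measure.measurePreserving_zsmul volume (by norm_num)
        have h1 := MeasurePreserving.integral_comp_of_aestronglyMeasurable hmp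
          (F := fun x => φ (t + x)) (hφ.comp (measurable_const_add t)).aestronglyMeasurable
        rw [integral_add_left_eq_self (fun x => φ x) t] at h1
        rw [← h1]
        congr 1 with x
        rw [two_zsmul, add_assoc]
      simp only [hin]
      rw [integral_mul_const, hP0, zero_mul]
    · exact measurePreserving_add_fst.integrable_comp_of_integrable hcross
  have h1 := integral_torus_comp_add hPφ
  obtain ⟨hi1, hi2, h2⟩ := integral_torus_eq hcross
  obtain ⟨hj1, hj2, -⟩ := integral_torus_eq (integrable_comp_add hPφ)
  have hi := hi1.add hi2
  have hj := hj1.add hj2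
  simp only [torusMk, torusMkNeg, ← AddCircle.coe_add, ← AddCircle.coe_sub, sub_neg_eq_add,
    ← sub_eq_add_neg, Pi.add_def] at hi hj h2
  rw [hcross0] at h2
  rw [← h1, ← sub_zero (∫ z, (P (z.1 + z.2 : ℝ) * φ (z.1 + z.2 : ℝ) + _) ∂areaOmega), h2,
    ← integral_sub hj hi]
  congr 1 with z
  ring

/-- A weak solution of `u_tt - u_xx + h = 0` splits into a bounded part and a part
`P(t + x) - P(t - x)` in the kernel of the d'Alembert operator, and `h` is orthogonal to that
kernel. -/
theorem exists_profile {u h : ℝ × ℝ → ℝ} (hu : Integrable u areaOmega)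
    (hh : Integrable h areaOmega)
    (heq : ∀ φ, IsTestFunction φ → ∫ z, (u z * dAlembert φ z + h z * φ z) ∂areaOmega = 0) :
    ∃ P : AddCircle (2 * π) → ℝ, Measurable P ∧ Integrable P ∧ ∫ s, P s = 0 ∧
      (∃ C, ∀ᵐ z ∂areaOmega, |u z - (P (z.1 + z.2 : ℝ) - P (z.1 - z.2 : ℝ))| ≤ C) ∧
      ∀ φ : AddCircle (2 * π) → ℝ, Measurable φ → (∃ C, ∀ s, |φ s| ≤ C) →
        ∫ z, u z * (φ (z.1 + z.2 : ℝ) - φ (z.1 - z.2 : ℝ)) ∂areaOmega = 2 * π * ∫ s, P s * φ s ∧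
        ∫ z, h z * (φ (z.1 + z.2 : ℝ) - φ (z.1 - z.2 : ℝ)) ∂areaOmega = 0 := by
  -- Measurable representatives are needed because `oddLift` evaluates its argument pointwise.
  obtain ⟨u', hu'm, huu'⟩ := hu.1
  obtain ⟨h', hh'm, hhh'⟩ := hh.1
  have hu' : Integrable u' areaOmega := hu.congr huu'
  have hh' : Integrable h' areaOmega := hh.congr hhh'
  have hU := integrable_oddLift hu'm.measurable hu'
  have hH := integrable_oddLift hh'm.measurable hh'
  -- `w` stands for `cos` or `sin`, so that both real modes in time are treated at once.
  have hmode : ∀ (k j : ℤ) (w : ℝ → ℝ), ContDiff ℝ ∞ w → (∀ t, w (t + 2 * π * k) = w t) →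
      (∀ t, iteratedDeriv 2 w t = -w t) → (∀ t, |w t| ≤ 1) →
      ((j : ℝ) ^ 2 - (k : ℝ) ^ 2) * ∫ z, u' z * (sin (j * z.2) * w (k * z.1)) ∂areaOmega +
        ∫ z, h' z * (sin (j * z.2) * w (k * z.1)) ∂areaOmega = 0 := by
    intro k j w hw hper hw2 hw1
    have hwc := hw.continuous
    have hbdd : ∀ v : ℝ × ℝ → ℝ, Integrable v areaOmega →
        Integrable (fun z => v z * (sin (j * z.2) * w (k * z.1))) areaOmega := fun v hv => by
      refine hv.mul_bdd (c := 1) (Continuous.aestronglyMeasurable (by fun_prop))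
        (Filter.Eventually.of_forall fun z => ?_)
      rw [norm_mul]
      exact mul_le_one₀ (abs_sin_le_one _) (norm_nonneg _) (hw1 _)
    rw [← heq _ (isTestFunction_sin_mul k j hw hper), ← integral_const_mul,
      ← integral_add ((hbdd u' hu').const_mul _) (hbdd h' hh')]
    refine integral_congr_ae ?_
    filter_upwards [huu', hhh'] with z h1 h2
    rw [dAlembert_sin_mul k j hw hw2, h1, h2]
    ring
  have hUH : ∀ k j : ℤ, ((j : ℂ) ^ 2 - (k : ℂ) ^ 2) *
      torusCoeff (fun z => (oddLift u' z : ℂ)) k j +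
        torusCoeff (fun z => (oddLift h' z : ℂ)) k j = 0 := by
    intro k j
    have h1 := hmode k j cos contDiff_cos
      (fun t => by rw [mul_comm, cos_add_int_mul_two_pi]) iteratedDeriv_two_cos abs_cos_le_one
    have h2 := hmode k j sin contDiff_sin
      (fun t => by rw [mul_comm, sin_add_int_mul_two_pi]) iteratedDeriv_two_sin abs_sin_le_one
    rw [torusCoeff_oddLift hu'm.measurable hu', torusCoeff_oddLift hh'm.measurable hh']
    have h1c := congrArg (fun r : ℝ => (r : ℂ)) h1
    have h2c := congrArg (fun r : ℝ => (r : ℂ)) h2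
    simp only [Complex.ofReal_add, Complex.ofReal_mul, Complex.ofReal_sub, Complex.ofReal_pow,
      Complex.ofReal_intCast, Complex.ofReal_zero] at h1c h2c
    linear_combination (-2 * Complex.I) * h1c - 2 * h2c * (Complex.I ^ 2) * (-1)
  -- On the diagonal the factor `j² - k²` vanishes and the equation constrains `h` alone.
  have hHdiag : ∀ k : ℤ, torusCoeff (fun z => (oddLift h' z : ℂ)) k k = 0 := fun k => by
    simpa using hUH k k
  obtain ⟨C, hC⟩ := exists_bound_sub_kernelPart hU hH (oddLift_odd u') (oddLift_odd h') hUH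
  refine ⟨profile (oddLift u'), measurable_profile (measurable_oddLift hu'm.measurable),
    integrable_profile hU, integral_profile_eq_zero hU (oddLift_odd u'), ⟨C, ?_⟩, ?_⟩
  · filter_upwards [ae_areaOmega_of_ae_torus hC, huu', ae_mem_interior_Omega] with z hz h1 h2
    rw [oddLift_torusMk u' h2.1 h2.2] at hz
    rwa [h1]
  · rintro φ hφ ⟨B, hB⟩
    have key : ∀ v : ℝ × ℝ → ℝ, Measurable v → Integrable v areaOmega →
        ∫ z, v z * (φ (z.1 + z.2 : ℝ) - φ (z.1 - z.2 : ℝ)) ∂areaOmega =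
          2 * π * ∫ s, profile (oddLift v) s * φ s := by
      intro v hvm hv
      have h1 := integral_smul_comp_add (integrable_oddLift hvm hv) hφ.stronglyMeasurable hB
      have h2 := integral_oddLift_smul hvm hv
        (Φ := fun z : AddCircle (2 * π) × AddCircle (2 * π) => φ (z.1 + z.2))
        (hφ.comp (by fun_prop)).stronglyMeasurable (fun z => hB _)
      rw [h1] at h2
      simp only [smul_eq_mul] at h2
      rw [h2]
      simp only [torusMk, torusMkNeg, ← AddCircle.coe_add, ← sub_eq_add_neg]
    constructor
    · rw [← key u' hu'm.measurable hu']
      refine integral_congr_ae ?_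
      filter_upwards [huu'] with z hz
      rw [hz]
    · have h0 : ∫ s, profile (oddLift h') s * φ s = 0 := by
        refine integral_eq_zero_of_ae ?_
        filter_upwards [profile_ae_eq_zero hH hHdiag] with s hs
        simp [hs]
      rw [← mul_zero (2 * π), ← h0, ← key h' hh'm.measurable hh']
      refine integral_congr_ae ?_
      filter_upwards [hhh'] with z hz
      rw [hz]

/-! ### The cut-off sign as test profile, and the bound on `P` and `Q`. -/

/-- The sign of `y`, cut off to zero on `[-M, M]`. -/
def cutoffSign (M y : ℝ) : ℝ := if M < y then 1 else if y < -M then -1 else 0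

theorem measurable_cutoffSign (M : ℝ) : Measurable (cutoffSign M) :=
  Measurable.ite measurableSet_Ioi measurable_const
    (Measurable.ite measurableSet_Iio measurable_const measurable_const)

theorem abs_cutoffSign_le (M y : ℝ) : |cutoffSign M y| ≤ 1 := by
  rw [cutoffSign]
  split_ifs <;> simp

theorem monotone_cutoffSign {M : ℝ} (hM : 0 ≤ M) : Monotone (cutoffSign M) := by
  intro y z hyz
  rw [cutoffSign, cutoffSign]
  split_ifs <;> linarith

theorem mul_abs_cutoffSign_le {M : ℝ} (hM : 0 ≤ M) (y : ℝ) :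
    M * |cutoffSign M y| ≤ y * cutoffSign M y := by
  rw [cutoffSign]
  split_ifs with h1 h2 <;> simp <;> linarith

/-- Coercivity of the coupled linear terms, tested with `cutoffSign`. -/
theorem cutoffSign_coupled_le {b ε M : ℝ} (hε : |ε| ≤ b) (hM : 0 ≤ M) (y z : ℝ) :
    (b - |ε|) * M * (|cutoffSign M y| + |cutoffSign M z|) ≤
      (b * (y * cutoffSign M y) + ε * (z * cutoffSign M y)) +
        (b * (z * cutoffSign M z) + ε * (y * cutoffSign M z)) := by
  have hy := mul_abs_cutoffSign_le hM y
  have hz := mul_abs_cutoffSign_le hM z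
  have habs : ∀ y, |y| * |cutoffSign M y| = y * cutoffSign M y := by
    intro y
    rw [← abs_mul, abs_of_nonneg]
    exact (mul_nonneg hM (abs_nonneg _)).trans (mul_abs_cutoffSign_le hM y)
  -- Rearrangement inequality: `|cutoffSign M y|` is the indicator of `|y| > M`, a nondecreasing
  -- function of `|y|`.
  have hsort : |z| * |cutoffSign M y| + |y| * |cutoffSign M z| ≤
      |y| * |cutoffSign M y| + |z| * |cutoffSign M z| := by
    have hval : ∀ y, |cutoffSign M y| = if M < |y| then 1 else 0 := by
      intro y
      rw [cutoffSign]
      split_ifs with h1 h2 h3 h4 h5 <;> simp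
      all_goals
        rw [lt_abs] at *
        rcases lt_or_ge 0 y with h | h <;> grind
    rw [hval, hval]
    split_ifs <;> linarith
  have h1 : -(|ε| * (|z| * |cutoffSign M y|)) ≤ ε * (z * cutoffSign M y) := by
    rw [← abs_mul, ← abs_mul]
    exact neg_abs_le _
  have h2 : -(|ε| * (|y| * |cutoffSign M z|)) ≤ ε * (y * cutoffSign M z) := by
    rw [← abs_mul, ← abs_mul]
    exact neg_abs_le _
  rw [habs y, habs z] at hsort
  nlinarith [mul_le_mul_of_nonneg_left hsort (abs_nonneg ε),
    mul_le_mul_of_nonneg_left (add_le_add hy hz) (sub_nonneg.2 hε)]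

/-- `F w - F r` has the sign of `w - r = a - c`, as does `T a - T c`, so their product is
nonnegative. Thus `F w` may be replaced by `F r`, which is bounded however large `a` and `c` are. -/
theorem mul_sub_ge_of_monotone {F T : ℝ → ℝ} (hF : Monotone F) (hT : Monotone T)
    {w r a c C K : ℝ} (hw : w = r + (a - c)) (hr : |r| ≤ C) (hK : ∀ y, |y| ≤ C → |F y| ≤ K) :
    -(K * (|T a| + |T c|)) ≤ F w * (T a - T c) := by
  have hFr := hK r hr
  have hd : |T a - T c| ≤ |T a| + |T c| := abs_sub _ _
  have hmono : F r * (T a - T c) ≤ F w * (T a - T c) := by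
    rcases le_total c a with h | h
    · exact mul_le_mul_of_nonneg_right (hF (by linarith)) (sub_nonneg.2 (hT h))
    · exact mul_le_mul_of_nonpos_right (hF (by linarith)) (sub_nonpos.2 (hT h))
  refine le_trans ?_ hmono
  refine le_trans ?_ (neg_abs_le _)
  rw [abs_mul]
  exact neg_le_neg (mul_le_mul hFr hd (abs_nonneg _) ((abs_nonneg _).trans hFr))

/-- The energy inequality obtained by testing one equation of the system with the kernel function
with profile `cutoffSign M ∘ P`. -/
theorem cutoffSign_energy_le {b ε p c₀ C : ℝ} (hp : 0 ≤ p) (hc₀ : 0 ≤ c₀)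
    {f : ℝ → ℝ → ℝ → ℝ} (hf : IsAdmissible p c₀ f) {u v : ℝ × ℝ → ℝ}
    (hu : Integrable u areaOmega) (hv : Integrable v areaOmega)
    (hfu : Integrable (fun z => f z.1 z.2 (u z)) areaOmega)
    {P Q : AddCircle (2 * π) → ℝ} (hPm : Measurable P) (hP : Integrable P) (hQ : Integrable Q)
    (hC : ∀ᵐ z ∂areaOmega, |u z - (P (z.1 + z.2 : ℝ) - P (z.1 - z.2 : ℝ))| ≤ C)
    (hu_test : ∀ φ : AddCircle (2 * π) → ℝ, Measurable φ → (∃ C, ∀ s, |φ s| ≤ C) →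
      ∫ z, u z * (φ (z.1 + z.2 : ℝ) - φ (z.1 - z.2 : ℝ)) ∂areaOmega = 2 * π * ∫ s, P s * φ s)
    (hv_test : ∀ φ : AddCircle (2 * π) → ℝ, Measurable φ → (∃ C, ∀ s, |φ s| ≤ C) →
      ∫ z, v z * (φ (z.1 + z.2 : ℝ) - φ (z.1 - z.2 : ℝ)) ∂areaOmega = 2 * π * ∫ s, Q s * φ s)
    (h_test : ∀ φ : AddCircle (2 * π) → ℝ, Measurable φ → (∃ C, ∀ s, |φ s| ≤ C) →
      ∫ z, (b * u z + ε * v z + f z.1 z.2 (u z)) *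
        (φ (z.1 + z.2 : ℝ) - φ (z.1 - z.2 : ℝ)) ∂areaOmega = 0)
    {M : ℝ} (hM : 0 ≤ M) :
    ∫ s, (b * (P s * cutoffSign M (P s)) + ε * (Q s * cutoffSign M (P s))) ≤
      c₀ * (1 + |C| ^ p) * ∫ s, |cutoffSign M (P s)| := by
  set φ : AddCircle (2 * π) → ℝ := fun s => cutoffSign M (P s) with hφdef
  have hφm : Measurable φ := (measurable_cutoffSign M).comp hPm
  have hφ1 : ∀ s, |φ s| ≤ 1 := fun s => abs_cutoffSign_le M _
  have hφb : ∃ C, ∀ s, |φ s| ≤ C := ⟨1, hφ1⟩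
  have hφi : Integrable φ := Integrable.of_bound hφm.aestronglyMeasurable 1
    (Filter.Eventually.of_forall hφ1)
  set Φ : ℝ × ℝ → ℝ := fun z => φ (z.1 + z.2 : ℝ) - φ (z.1 - z.2 : ℝ) with hΦdef
  have hΦm : Measurable Φ :=
    (hφm.comp (AddCircle.measurable_mk'.comp (measurable_fst.add measurable_snd))).sub
      (hφm.comp (AddCircle.measurable_mk'.comp (measurable_fst.sub measurable_snd)))
  have hΦ : ∀ w : ℝ × ℝ → ℝ, Integrable w areaOmega → Integrable (fun z => w z * Φ z) areaOmega :=
    fun w hw => hw.mul_bdd (c := 1 + 1) hΦm.aestronglyMeasurable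
      (Filter.Eventually.of_forall fun z => (abs_sub _ _).trans (add_le_add (hφ1 _) (hφ1 _)))
  have hPφ : Integrable (fun s => P s * φ s) :=
    hP.mul_bdd (c := 1) hφm.aestronglyMeasurable (Filter.Eventually.of_forall hφ1)
  have hQφ : Integrable (fun s => Q s * φ s) :=
    hQ.mul_bdd (c := 1) hφm.aestronglyMeasurable (Filter.Eventually.of_forall hφ1)
  have habs := integral_torus_comp_add hφi.abs
  obtain ⟨hi1, hi2, -⟩ := integral_torus_eq (integrable_comp_add hφi.abs)
  have hi := hi1.add hi2
  simp only [torusMk, torusMkNeg, ← AddCircle.coe_add, ← sub_eq_add_neg, Pi.add_def] at hi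
  -- The constant is the growth bound for `f` at the bounded part of `u`, so it is independent of
  -- `M`. Unfolding `Ω` to the torus turns `|φ(t + x)| + |φ(t - x)|` into `2π ∫ |φ|`.
  have hlow : -(c₀ * (1 + |C| ^ p) * (2 * π * ∫ s, |φ s|)) ≤
      ∫ z, f z.1 z.2 (u z) * Φ z ∂areaOmega := by
    rw [← habs, ← integral_const_mul, ← integral_neg]
    refine integral_mono_ae (hi.const_mul _).neg (hΦ _ hfu) ?_
    filter_upwards [hC, ae_mem_interior_Omega] with z hz hzm
    have hx : z.2 ∈ Set.Icc 0 π := Set.Ioo_subset_Icc_self hzm.2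
    refine mul_sub_ge_of_monotone (hf.monotone z.1 z.2 hx) (monotone_cutoffSign hM)
      (sub_add_cancel (u z) _).symm hz fun y hy => ?_
    refine (hf.growth z.1 z.2 hx y).trans ?_
    gcongr c₀ * (1 + ?_ ^ p)
    exact hy.trans (le_abs_self C)
  have hlin : Integrable (fun z => b * (u z * Φ z) + ε * (v z * Φ z)) areaOmega :=
    ((hΦ u hu).const_mul b).add ((hΦ v hv).const_mul ε)
  have hsum : b * (2 * π * ∫ s, P s * φ s) + ε * (2 * π * ∫ s, Q s * φ s) +
      ∫ z, f z.1 z.2 (u z) * Φ z ∂areaOmega = 0 := by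
    rw [← hu_test φ hφm hφb, ← hv_test φ hφm hφb, ← h_test φ hφm hφb, ← integral_const_mul,
      ← integral_const_mul, ← integral_add ((hΦ u hu).const_mul b) ((hΦ v hv).const_mul ε),
      ← integral_add hlin (hΦ _ hfu)]
    congr 1 with z
    simp only [hΦdef]
    ring
  rw [integral_add (hPφ.const_mul b) (hQφ.const_mul ε), integral_const_mul, integral_const_mul]
  have h2pi := two_pi_pos
  refine le_of_mul_le_mul_left ?_ h2pi
  linarith

/-- If the energy inequalities hold for both profiles, then both profiles are bounded. -/
theorem ae_abs_le_of_energy_le {b ε K₁ K₂ M : ℝ} (hε : |ε| ≤ b) (hM : 0 ≤ M)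
    (hM₁ : K₁ < (b - |ε|) * M) (hM₂ : K₂ < (b - |ε|) * M)
    {X : Type*} [MeasurableSpace X] {μ : Measure X} [IsFiniteMeasure μ]
    {P Q : X → ℝ} (hPm : Measurable P)
    (hQm : Measurable Q) (hP : Integrable P μ) (hQ : Integrable Q μ)
    (h₁ : ∫ s, (b * (P s * cutoffSign M (P s)) + ε * (Q s * cutoffSign M (P s))) ∂μ ≤
      K₁ * ∫ s, |cutoffSign M (P s)| ∂μ)
    (h₂ : ∫ s, (b * (Q s * cutoffSign M (Q s)) + ε * (P s * cutoffSign M (Q s))) ∂μ ≤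
      K₂ * ∫ s, |cutoffSign M (Q s)| ∂μ) :
    ∀ᵐ s ∂μ, |P s| ≤ M ∧ |Q s| ≤ M := by
  have hmul : ∀ R S : X → ℝ, Integrable R μ → Measurable S →
      Integrable (fun s => R s * cutoffSign M (S s)) μ := fun R S hR hS =>
    hR.mul_bdd (c := 1) ((measurable_cutoffSign M).comp hS).aestronglyMeasurable
      (Filter.Eventually.of_forall fun s => abs_cutoffSign_le M _)
  have habs : ∀ S : X → ℝ, Measurable S → Integrable (fun s => |cutoffSign M (S s)|) μ :=
    fun S hS => (Integrable.of_bound ((measurable_cutoffSign M).comp hS).aestronglyMeasurable 1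
      (Filter.Eventually.of_forall fun s => abs_cutoffSign_le M _)).abs
  have hI₁ : Integrable (fun s => b * (P s * cutoffSign M (P s)) +
      ε * (Q s * cutoffSign M (P s))) μ := ((hmul P P hP hPm).const_mul b).add ((hmul Q P hQ hPm).const_mul ε)
  have hI₂ : Integrable (fun s => b * (Q s * cutoffSign M (Q s)) +
      ε * (P s * cutoffSign M (Q s))) μ := ((hmul Q Q hQ hQm).const_mul b).add ((hmul P Q hP hQm).const_mul ε)
  have hle := integral_mono (((habs P hPm).add (habs Q hQm)).const_mul ((b - |ε|) * M))
    (hI₁.add hI₂) fun s => cutoffSign_coupled_le hε hM (P s) (Q s)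
  simp only [Pi.add_apply] at hle
  rw [integral_const_mul, integral_add hI₁ hI₂] at hle
  rw [integral_add (habs P hPm) (habs Q hQm)] at hle
  have hnnP : 0 ≤ ∫ s, |cutoffSign M (P s)| ∂μ := integral_nonneg fun s => abs_nonneg _
  have hnnQ : 0 ≤ ∫ s, |cutoffSign M (Q s)| ∂μ := integral_nonneg fun s => abs_nonneg _
  -- The sum of the energy inequalities bounds `(b - |ε|) M` times the sum of the two nonnegative
  -- integrals by `K₁` and `K₂` times each; the strict inequalities leave only zero.
  have hzP : ∫ s, |cutoffSign M (P s)| ∂μ = 0 := by nlinarith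
  have hzQ : ∫ s, |cutoffSign M (Q s)| ∂μ = 0 := by nlinarith
  rw [integral_eq_zero_iff_of_nonneg (fun s => abs_nonneg _) (habs P hPm)] at hzP
  rw [integral_eq_zero_iff_of_nonneg (fun s => abs_nonneg _) (habs Q hQm)] at hzQ
  have hcut : ∀ y, |cutoffSign M y| = 0 → |y| ≤ M := by
    intro y hy
    rw [abs_eq_zero, cutoffSign] at hy
    split_ifs at hy with h1 h2
    · norm_num at hy
    · norm_num at hy
    · exact abs_le.2 ⟨by linarith, by linarith⟩
  filter_upwards [hzP, hzQ] with s h1 h2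
  exact ⟨hcut _ h1, hcut _ h2⟩

/-! ### Assembling the bounded decomposition. -/

/-- A bounded profile gives the decomposition of `u` into bounded parts. -/
theorem hasBoundedParts_of_profile {u : ℝ × ℝ → ℝ} (hu : Integrable u areaOmega)
    {P : AddCircle (2 * π) → ℝ} (hPm : Measurable P) (hP : Integrable P) (hP0 : ∫ s, P s = 0)
    {C M : ℝ} (hC : ∀ᵐ z ∂areaOmega, |u z - (P (z.1 + z.2 : ℝ) - P (z.1 - z.2 : ℝ))| ≤ C)
    (hM : ∀ᵐ s, |P s| ≤ M)
    (hu_test : ∀ φ : AddCircle (2 * π) → ℝ, Measurable φ → (∃ C, ∀ s, |φ s| ≤ C) →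
      ∫ z, u z * (φ (z.1 + z.2 : ℝ) - φ (z.1 - z.2 : ℝ)) ∂areaOmega = 2 * π * ∫ s, P s * φ s) :
    MemLp u ⊤ areaOmega ∧ HasBoundedParts u := by
  -- `R` is a version of `P` that is bounded at every point.
  set R : AddCircle (2 * π) → ℝ := fun s => if |P s| ≤ M then P s else 0 with hRdef
  have hRm : Measurable R :=
    Measurable.ite (measurableSet_le hPm.abs measurable_const) hPm measurable_const
  have hRb : ∀ s, |R s| ≤ |M| := by
    intro s
    simp only [hRdef]
    split_ifs with h
    · exact h.trans (le_abs_self M)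
    · simp
  have hPR : P =ᵐ[volume] R := by
    filter_upwards [hM] with s hs
    simp [hRdef, hs]
  have hRi : Integrable R := hP.congr hPR
  have hR0 : ∫ s, R s = 0 := by rw [← integral_congr_ae hPR, hP0]
  have hmk : Measurable (fun z : ℝ × ℝ => R (z.1 + z.2 : ℝ) - R (z.1 - z.2 : ℝ)) :=
    (hRm.comp (AddCircle.measurable_mk'.comp (measurable_fst.add measurable_snd))).sub
      (hRm.comp (AddCircle.measurable_mk'.comp (measurable_fst.sub measurable_snd)))
  have hNb : ∀ z : ℝ × ℝ, ‖R (z.1 + z.2 : ℝ) - R (z.1 - z.2 : ℝ)‖ ≤ |M| + |M| := fun z =>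
    (abs_sub _ _).trans (add_le_add (hRb _) (hRb _))
  have hNtop : MemLp (fun z : ℝ × ℝ => R (z.1 + z.2 : ℝ) - R (z.1 - z.2 : ℝ)) ⊤ areaOmega :=
    memLp_top_of_bound hmk.aestronglyMeasurable _ (Filter.Eventually.of_forall hNb)
  have hNPR : ∀ᵐ z ∂areaOmega, P (z.1 + z.2 : ℝ) - P (z.1 - z.2 : ℝ) =
      R (z.1 + z.2 : ℝ) - R (z.1 - z.2 : ℝ) := by
    have h1 : ∀ᵐ w : AddCircle (2 * π) × AddCircle (2 * π), P (w.1 + w.2) = R (w.1 + w.2) :=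
      measurePreserving_add_fst.quasiMeasurePreserving.ae
        (p := fun w : AddCircle (2 * π) × AddCircle (2 * π) => P w.1 = R w.1)
        (Measure.quasiMeasurePreserving_fst.ae hPR)
    have h2 : ∀ᵐ w : AddCircle (2 * π) × AddCircle (2 * π), P (w.1 - w.2) = R (w.1 - w.2) :=
      measurePreserving_sub_fst.quasiMeasurePreserving.ae
        (p := fun w : AddCircle (2 * π) × AddCircle (2 * π) => P w.1 = R w.1)
        (Measure.quasiMeasurePreserving_fst.ae hPR)
    filter_upwards [ae_areaOmega_of_ae_torus h1, ae_areaOmega_of_ae_torus h2] with z hz1 hz2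
    simp only [torusMk, ← AddCircle.coe_add, ← AddCircle.coe_sub] at hz1 hz2
    rw [hz1, hz2]
  set u₁ : ℝ × ℝ → ℝ := fun z => u z - (R (z.1 + z.2 : ℝ) - R (z.1 - z.2 : ℝ)) with hu₁def
  have hu₁top : MemLp u₁ ⊤ areaOmega := by
    refine memLp_top_of_bound (hu.1.sub hmk.aestronglyMeasurable) C ?_
    filter_upwards [hC, hNPR] with z hz hz2
    rw [hz2] at hz
    exact hz
  -- The function `u` and its kernel part with profile `R` have the same pairing `2π ∫ P φ` with
  -- every bounded kernel function.
  have htest : ∀ φ : AddCircle (2 * π) → ℝ, Measurable φ → (∀ s, |φ s| ≤ 1) →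
      ∫ z, u₁ z * (φ (z.1 + z.2 : ℝ) - φ (z.1 - z.2 : ℝ)) ∂areaOmega = 0 := by
    intro φ hφ hφ1
    have hΦm : Measurable fun z : ℝ × ℝ => φ (z.1 + z.2 : ℝ) - φ (z.1 - z.2 : ℝ) :=
      (hφ.comp (AddCircle.measurable_mk'.comp (measurable_fst.add measurable_snd))).sub
        (hφ.comp (AddCircle.measurable_mk'.comp (measurable_fst.sub measurable_snd)))
    have hmul : ∀ w : ℝ × ℝ → ℝ, Integrable w areaOmega → Integrable
        (fun z => w z * (φ (z.1 + z.2 : ℝ) - φ (z.1 - z.2 : ℝ))) areaOmega := fun w hw =>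
      hw.mul_bdd (c := 1 + 1) hΦm.aestronglyMeasurable
        (Filter.Eventually.of_forall fun z => (abs_sub _ _).trans (add_le_add (hφ1 _) (hφ1 _)))
    simp only [hu₁def, sub_mul (u _)]
    rw [integral_sub (hmul u hu) (hmul _ (hNtop.integrable le_top)), hu_test φ hφ ⟨1, hφ1⟩,
      integral_kernelPart_mul hRi hR0 hφ hφ1, sub_eq_zero]
    congr 1
    refine integral_congr_ae ?_
    filter_upwards [hPR] with s hs
    rw [hs]
  have htrig : ∀ (w : ℝ → ℝ), Continuous w → Function.Periodic w (2 * π) → (∀ t, |w t| ≤ 1) →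
      ∫ z, u₁ z * (w (z.1 + z.2) - w (z.1 - z.2)) ∂areaOmega = 0 := fun w hw hper hw1 => by
    refine htest hper.lift ?_ ?_
    · have hc : Continuous hper.lift := hw.quotient_liftOn' _
      exact hc.measurable
    · intro s
      induction s using QuotientAddGroup.induction_on with
      | H t => exact hw1 t
  refine ⟨(hu₁top.add hNtop).ae_eq (Filter.Eventually.of_forall fun z => by simp [hu₁def]),
    u₁, fun s => R s, hu₁top, fun j hj => ⟨?_, ?_⟩, ?_, ?_, ?_, ?_⟩
  -- `sin j(t + x) - sin j(t - x) = 2 sin (j x) cos (j t)`; the cosine profile gives `-2 sin (j x)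
  -- sin (j t)`.
  · have h := htrig (fun t => sin (j * t)) (by fun_prop)
      (fun t => by beta_reduce; rw [mul_add, sin_add_nat_mul_two_pi]) fun t => abs_sin_le_one _
    rw [← mul_zero (1 / 2), ← h, ← integral_const_mul]
    congr 1 with z
    rw [mul_add (j : ℝ), mul_sub (j : ℝ), sin_add, sin_sub]
    ring
  · have h := htrig (fun t => cos (j * t)) (by fun_prop)
      (fun t => by beta_reduce; rw [mul_add, cos_add_nat_mul_two_pi]) fun t => abs_cos_le_one _
    rw [← mul_zero (-1 / 2), ← h, ← integral_const_mul]
    congr 1 with z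
    rw [mul_add (j : ℝ), mul_sub (j : ℝ), cos_add, cos_sub]
    ring
  · intro s
    simp
  · exact memLp_top_of_bound (hRm.comp AddCircle.measurable_mk').aestronglyMeasurable _
      (Filter.Eventually.of_forall fun s => hRb s)
  · have h := AddCircle.intervalIntegral_preimage (2 * π) 0 R
    rw [zero_add] at h
    exact h.trans hR0
  · exact Filter.Eventually.of_forall fun z => by simp [hu₁def]

end KleinGordon

end

theorem theorem1p4 (b : ℝ) (hb : 0 < b) (hbL : -b ∉ KleinGordon.waveSpectrum)
    (f g : ℝ → ℝ → ℝ → ℝ) (p q c₀ : ℝ) (hp : 1 < p) (hq : 1 < q) (hc₀ : 0 < c₀)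
    (hf : KleinGordon.IsAdmissible p c₀ f) (hg : KleinGordon.IsAdmissible q c₀ g) :
    ∃ ε₀ > 0, ∀ ε : ℝ, |ε| < ε₀ → ∀ u v : ℝ × ℝ → ℝ,
      KleinGordon.IsWeakSolution b ε f g u v →
        (MeasureTheory.MemLp u ⊤ KleinGordon.areaOmega ∧
          MeasureTheory.MemLp v ⊤ KleinGordon.areaOmega) ∧
        (KleinGordon.HasBoundedParts u ∧ KleinGordon.HasBoundedParts v) := by
  open KleinGordon MeasureTheory in
  -- The threshold is `b` itself, since coercivity of the coupled linear part only needs `b - |ε| >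
  -- 0`.
  refine ⟨b, hb, fun ε hε u v huv => ?_⟩
  have hu : Integrable u areaOmega := huv.memLp_u.integrable one_le_two
  have hv : Integrable v areaOmega := huv.memLp_v.integrable one_le_two
  obtain ⟨P, hPm, hP, hP0, ⟨C, hC⟩, hPtest⟩ := exists_profile hu
    (h := fun z => b * u z + ε * v z + f z.1 z.2 (u z))
    (((hu.const_mul b).add (hv.const_mul ε)).add huv.integrable_f) fun φ hφ => by
      rw [← huv.eq_u φ hφ]
      congr 1 with z
      ring
  obtain ⟨Q, hQm, hQ, hQ0, ⟨D, hD⟩, hQtest⟩ := exists_profile hv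
    (h := fun z => b * v z + ε * u z + g z.1 z.2 (v z))
    (((hv.const_mul b).add (hu.const_mul ε)).add huv.integrable_g) fun φ hφ => by
      rw [← huv.eq_v φ hφ]
      congr 1 with z
      ring
  have hPt := fun φ h1 h2 => (hPtest φ h1 h2).1
  have hQt := fun φ h1 h2 => (hQtest φ h1 h2).1
  set K₁ := c₀ * (1 + |C| ^ p)
  set K₂ := c₀ * (1 + |D| ^ q)
  have hK₁ : 0 ≤ K₁ := by positivity
  have hK₂ : 0 ≤ K₂ := by positivity
  have hbε : 0 < b - |ε| := sub_pos.2 hε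
  -- Chosen so that `(b - |ε|) M` exceeds both `K₁` and `K₂`; it may depend on the solution through
  -- `C` and `D`.
  set M := (K₁ + K₂ + 1) / (b - |ε|)
  have hM : 0 ≤ M := by positivity
  have hbM : (b - |ε|) * M = K₁ + K₂ + 1 := mul_div_cancel₀ _ hbε.ne'
  have hae := ae_abs_le_of_energy_le hε.le hM (by linarith : K₁ < _) (by linarith : K₂ < _)
    hPm hQm hP hQ
    (cutoffSign_energy_le (by linarith) hc₀.le hf hu hv huv.integrable_f hPm hP hQ hC hPt hQt
      (fun φ h1 h2 => (hPtest φ h1 h2).2) hM)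
    (cutoffSign_energy_le (by linarith) hc₀.le hg hv hu huv.integrable_g hQm hQ hP hD hQt hPt
      (fun φ h1 h2 => (hQtest φ h1 h2).2) hM)
  have h1 := hasBoundedParts_of_profile hu hPm hP hP0 hC (hae.mono fun s hs => hs.1) hPt
  have h2 := hasBoundedParts_of_profile hv hQm hQ hQ0 hD (hae.mono fun s hs => hs.2) hQt
  exact ⟨⟨h1.1, h2.1⟩, h1.2, h2.2⟩
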